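/- **Theorem (propagation of chaos).** Let $\alpha\ge 0$, $\theta>0$, $\sigma\in\mathbb R$, $\mu_0\in\mathbb R$, and let $\lambda$ be a probability measure on $\mathbb R$ with $\int |r|^3\,\lambda(dr)<\infty$. For $N\ge 1$ let $(x_1^{(N)},\dots,x_N^{(N)},\mu^{(N)})$ be the solution (with continuous paths, on $[0,\infty)$) of $$dx_i(t)=\big(-x_i^3(t)+x_i(t)\big)dt-\mu(t)\,dt+\sigma\,dw_i(t),\qquad i=1,\dots,N,$$ $$d\mu(t)=-(\alpha-\theta)\mu(t)\,dt-\frac{\theta}{N}\sum_{i=1}^N\big(-x_i^3(t)+x_i(t)\big)dt-\frac{\theta\sigma}{N}\sum_{i=1}^N dw_i(t),$$ where $w_1,\dots,w_N$ are independent standard Brownian motions, the initial positions $x_i^{(N)}(0)$, $i=1,\dots,N$, are i.i.d. with law $\lambda$ and independent of $(w_1,\dots,w_N)$, and $\mu^{(N)}(0)=\mu_0$. By a solution of the limit equation with data $(\lambda,\mu_0)$, driven by a standard Brownian motion $B$, we mean a pair $(y,\nu)$ of a process $y$ with continuous paths and a deterministic function $\nu$ on $[0,\infty)$ such that $y(0)$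 has law $\lambda$ and is independent of $B$, $\nu(0)=\mu_0$, $\mathbb E|y(t)|^3<\infty$ for all $t\ge 0$, and $$dy(t)=\big(-y^3(t)+y(t)\big)dt-\nu(t)\,dt+\sigma\,dB(t),\qquad \frac{d\nu}{dt}(t)=-(\alpha-\theta)\nu(t)+\theta\,\mathbb E\big[y^3(t)-y(t)\big].$$ 1. (Convergence in law.) For every $k\ge1$ and every $T\ge 0$, as $N\to\infty$, the process $(x_1^{(N)},\dots,x_k^{(N)})$ restricted to $[0,T]$ converges in law, in $C([0,T],\mathbb R^k)$ with the uniform topology, to $(y_1,\dots,y_k)$ restricted to $[0,T]$, where $y_1,\dots,y_k$ are independent copies of the solution of the limit equation with data $(\lambda,\mu_0)$. 2. (Coupling bound.) For every $T\ge 0$ there is a constant $K_T>0$, depending only on $T,\alpha,\theta,\sigma,\mu_0,\lambda$, such that for all $N\ge 1$ and $1\le i\le N$: if $(y_i,\nu)$ is the solution of the limit equation with data $(\lambda,\mu_0)$ driven by $B=w_i$ with $y_i(0)=x_i^{(N)}(0)$ almost surely, then $$\mathbb E\Big[\sup_{t\in[0,T]}\big|x_i^{(N)}(t)-y_i(t)\big|\Big]\le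 \frac{K_T}{\sqrt N}.$$ -/

import Mathlib

open MeasureTheory ProbabilityTheory Filter Topology
open scoped NNReal ENNReal

namespace CooperativeModel

/-- The force `-U'(x) = -x³ + x` of the double-well potential `U(x) = x⁴/4 - x²/2`. -/
def force (x : ℝ) : ℝ := -x ^ 3 + x

/-- `(x₁, …, x_N, μ)` solves, on `[0, ∞)`, the `N`-particle system
`dxᵢ = (-xᵢ³ + xᵢ) dt - μ dt + σ dwᵢ`,
`dμ = -(α - θ) μ dt - (θ/N) ∑ᵢ (-xᵢ³ + xᵢ) dt - (θσ/N) ∑ᵢ dwᵢ`,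
driven by independent standard Brownian motions `w₁, …, w_N`.
The noise is additive, so the equations are, almost surely, integral equations
for the continuous paths, without any stochastic integral. -/
structure IsParticleSolution {Ω : Type*} [MeasurableSpace Ω] (α θ σ : ℝ) {N : ℕ}
    (w x : Fin N → ℝ≥0 → Ω → ℝ) (μ : ℝ≥0 → Ω → ℝ) (P : Measure Ω) : Prop where
  isBrownian : ∀ i, IsBrownianReal (w i) P
  indep_brownian : iIndepFun (fun i ω t ↦ w i t ω) P
  aemeasurable_position : ∀ i t, AEMeasurable (x i t) P
  aemeasurable_field : ∀ t, AEMeasurable (μ t) P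
  continuous_position : ∀ᵐ ω ∂P, ∀ i, Continuous fun t ↦ x i t ω
  continuous_field : ∀ᵐ ω ∂P, Continuous fun t ↦ μ t ω
  position_eq : ∀ᵐ ω ∂P, ∀ i, ∀ t : ℝ≥0,
    x i t ω = x i 0 ω
      + (∫ s in (0 : ℝ)..t, (force (x i s.toNNReal ω) - μ s.toNNReal ω))
      + σ * w i t ω
  field_eq : ∀ᵐ ω ∂P, ∀ t : ℝ≥0,
    μ t ω = μ 0 ω
      + (∫ s in (0 : ℝ)..t, (-(α - θ) * μ s.toNNReal ω
          - θ / N * ∑ i, force (x i s.toNNReal ω)))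
      - θ * σ / N * ∑ i, w i t ω

/-- The `N`-particle system started from i.i.d. positions of law `lam`, independent of the
Brownian motions, and from the deterministic value `μ₀` of `μ`. -/
structure IsChaoticParticleSystem {Ω : Type*} [MeasurableSpace Ω] (α θ σ μ₀ : ℝ)
    (lam : Measure ℝ) {N : ℕ}
    (w x : Fin N → ℝ≥0 → Ω → ℝ) (μ : ℝ≥0 → Ω → ℝ) (P : Measure Ω) : Prop where
  solution : IsParticleSolution α θ σ w x μ P
  law_initial : ∀ i, HasLaw (x i 0) lam P
  indep_initial : iIndepFun (fun i ↦ x i 0) P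
  indep_initial_brownian : IndepFun (fun ω i ↦ x i 0 ω) (fun ω i t ↦ w i t ω) P
  field_initial : ∀ᵐ ω ∂P, μ 0 ω = μ₀

/-- `(y, ν)` solves, on `[0, ∞)`, the McKean–Vlasov equation
`dy = (-y³ + y) dt - ν dt + σ dB`, `dν/dt = -(α - θ) ν + θ E[y³ - y]`,
with `B` a standard Brownian motion, `y(0)` of law `lam` and independent of `B`, `ν(0) = μ₀`.
The function `ν` is deterministic; only its restriction to `[0, ∞)` matters. The integrability
field says that the expectation in the equation for `ν` is defined. -/
structure IsMcKeanVlasovSolution {Ω : Type*} [MeasurableSpace Ω] (α θ σ μ₀ : ℝ)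
    (lam : Measure ℝ) (B y : ℝ≥0 → Ω → ℝ) (ν : ℝ → ℝ) (P : Measure Ω) : Prop where
  isBrownian : IsBrownianReal B P
  aemeasurable_position : ∀ t, AEMeasurable (y t) P
  continuous_position : ∀ᵐ ω ∂P, Continuous fun t ↦ y t ω
  law_initial : HasLaw (y 0) lam P
  indep_initial_brownian : IndepFun (y 0) (fun ω t ↦ B t ω) P
  position_eq : ∀ᵐ ω ∂P, ∀ t : ℝ≥0,
    y t ω = y 0 ω
      + (∫ s in (0 : ℝ)..t, (force (y s.toNNReal ω) - ν s))
      + σ * B t ω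
  field_initial : ν 0 = μ₀
  integrable_moment : ∀ t, Integrable (fun ω ↦ y t ω ^ 3 - y t ω) P
  field_eq : ∀ t : ℝ≥0,
    HasDerivWithinAt ν (-(α - θ) * ν t + θ * ∫ ω, (y t ω ^ 3 - y t ω) ∂P) (Set.Ici 0) t

/-- The space of continuous paths carries the Borel σ-algebra of uniform convergence. -/
instance pathMeasurableSpace (T : ℝ≥0) (k : ℕ) :
    MeasurableSpace C(Set.Icc (0 : ℝ≥0) T, Fin k → ℝ) := borel _

instance pathBorelSpace (T : ℝ≥0) (k : ℕ) :
    BorelSpace C(Set.Icc (0 : ℝ≥0) T, Fin k → ℝ) := ⟨rfl⟩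

open Classical in
/-- The path on `[0, T]` of the vector-valued process `(X₁, …, X_k)`, as an element of
`C([0, T], ℝᵏ)`. Where the paths are not continuous (a null set for the processes considered
here) the value is the zero path. -/
noncomputable def pathOn {Ω : Type*} (T : ℝ≥0) {k : ℕ} (X : Fin k → ℝ≥0 → Ω → ℝ) (ω : Ω) :
    C(Set.Icc (0 : ℝ≥0) T, Fin k → ℝ) :=
  if h : ∀ i, Continuous fun t ↦ X i t ω then
    ⟨fun t i ↦ X i t ω, continuous_pi fun i ↦ (h i).comp continuous_subtype_val⟩
  else 0

end CooperativeModel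

namespace CooperativeModel

/-! ### One-sided Gronwall estimates -/

/-! The cubic drift is not Lipschitz, so a direct Gronwall argument on the pair (position, field)
fails: the equation for the field contains an average of cubic terms. Two facts replace it.

First, the force is one-sided Lipschitz (`force_oneSided`). Hence two positions with the same start
and the same noise differ by at most `e^T ∫ |μ - ν|`, whatever their size (`abs_sub_le_of_field`).
Second, in `μ + θ x̄`, with `x̄` the empirical mean, force and noise cancel: `d(μ + θ x̄) = -α μ dt`
(`field_add_mean_eq`). In the limit, likewise, `(ν + θ E y)' = -α ν`, which is `IsMeanField` in
integrated form. Subtracting the two identities bounds `|μ - ν|` by `(θ e^T + α) ∫ |μ - ν|` plus the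
deviations of the empirical means of independent copies of `y(t)` and `y(0)` from their
expectations. Gronwall's inequality leaves only these deviations (`abs_position_sub_flow_le`), and
by independence they are of order `1 / √N` in mean, given second moments
(`integral_abs_mean_sub_le`). No moment of the particles themselves is needed.

The noise is additive, so for a given field the equation is solved path by path, and the solution is
a continuous function `flow` of the initial position and the noise path. The same map can therefore
be applied on any probability space. A limit solution is the image under `flow` of its data
(`IsMcKeanVlasovSolution.exists_isMeanField`), so its law is determined by its field and the law of
the data. Evaluating `flow` at the data of the particles gives independent copies of the limit on
the space of the particles, and the coupling estimate against these copies yields convergence in law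
(`tendstoInDistribution_of_coupling`).

The constant must not depend on the chosen solution. This follows from a priori bounds: `flow` stays
close to its noise, and a mean field has an integral bounded by the data alone
(`IsMeanField.integral_abs_le`). -/

lemma le_of_hasDerivAt_nonpos {F F' : ℝ → ℝ} {T t : ℝ} (hF : ∀ x, HasDerivAt F (F' x) x)
    (hF' : ∀ x ∈ Set.Ioo 0 T, F' x ≤ 0) (ht : t ∈ Set.Icc 0 T) : F t ≤ F 0 := by
  have hc : Continuous F := continuous_iff_continuousAt.2 fun x ↦ (hF x).continuousAt
  refine antitoneOn_of_deriv_nonpos (convex_Icc 0 T) hc.continuousOn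
    (fun x _ ↦ (hF x).differentiableAt.differentiableWithinAt) (fun x hx ↦ ?_)
    (Set.left_mem_Icc.2 (ht.1.trans ht.2)) ht ht.1
  rw [(hF x).deriv]
  exact hF' x (by simpa using hx)

/-- Integral form of Gronwall's inequality. -/
lemma integral_abs_le_of_abs_le_integral {e R : ℝ → ℝ} {L T : ℝ} (he : Continuous e)
    (hR : Continuous R) (hR0 : ∀ t, 0 ≤ R t) (hL : 0 ≤ L) (hT : 0 ≤ T)
    (h : ∀ t ∈ Set.Icc 0 T, |e t| ≤ L * (∫ s in (0 : ℝ)..t, |e s|) + R t) :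
    ∫ s in (0 : ℝ)..T, |e s| ≤ Real.exp (L * T) * ∫ s in (0 : ℝ)..T, R s := by
  have hG (t : ℝ) := (he.abs.integral_hasStrictDerivAt 0 t).hasDerivAt
  have hI (t : ℝ) := (hR.integral_hasStrictDerivAt 0 t).hasDerivAt
  have hE (t : ℝ) : HasDerivAt (fun t ↦ Real.exp (-L * t)) (Real.exp (-L * t) * -L) t := by
    simpa using ((hasDerivAt_id t).const_mul (-L)).exp
  -- The function `e^{-Lt} ∫₀ᵗ |e| - ∫₀ᵗ R` is nonincreasing: its derivative is at most `(e^{-Lt} -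
  -- 1) R`.
  have hF (t : ℝ) := ((hE t).mul (hG t)).sub (hI t)
  have key := le_of_hasDerivAt_nonpos (T := T) hF (fun x hx ↦ ?_) ⟨hT, le_rfl⟩
  · simp only [Pi.sub_apply, Pi.mul_apply, intervalIntegral.integral_same, mul_zero, sub_zero,
      sub_nonpos] at key
    calc ∫ s in (0 : ℝ)..T, |e s|
        = Real.exp (L * T) * (Real.exp (-L * T) * ∫ s in (0 : ℝ)..T, |e s|) := by
          rw [← mul_assoc, ← Real.exp_add]; simp
      _ ≤ _ := by gcongr
  · have h1 := h x ⟨hx.1.le, hx.2.le⟩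
    have h2 : Real.exp (-L * x) ≤ 1 := Real.exp_le_one_iff.2 (by nlinarith [hx.1])
    have h3 := Real.exp_pos (-L * x)
    have h4 := hR0 x
    nlinarith

/-- If `u = u₀ + ∫ v` and `u v ≤ |u| (|u| + h)`, then `|u(t)| ≤ eᵗ (|u₀| + ∫ h)`. -/
lemma abs_le_exp_mul_of_mul_le {v h : ℝ → ℝ} {u₀ T : ℝ} (hv : Continuous v) (hh : Continuous h)
    (hh0 : ∀ t, 0 ≤ h t)
    (huv : ∀ t ∈ Set.Icc 0 T, (u₀ + ∫ s in (0 : ℝ)..t, v s) * v t ≤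
      |u₀ + ∫ s in (0 : ℝ)..t, v s| * (|u₀ + ∫ s in (0 : ℝ)..t, v s| + h t))
    {t : ℝ} (ht : t ∈ Set.Icc 0 T) :
    |u₀ + ∫ s in (0 : ℝ)..t, v s| ≤ Real.exp t * (|u₀| + ∫ s in (0 : ℝ)..t, h s) := by
  set u : ℝ → ℝ := fun t ↦ u₀ + ∫ s in (0 : ℝ)..t, v s with hu
  have hud (t : ℝ) : HasDerivAt u (v t) t :=
    ((hv.integral_hasStrictDerivAt 0 t).hasDerivAt).const_add u₀
  have hI (t : ℝ) := (hh.integral_hasStrictDerivAt 0 t).hasDerivAt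
  have hE (t : ℝ) : HasDerivAt (fun t ↦ Real.exp (-t)) (-Real.exp (-t)) t := by
    simpa using (hasDerivAt_neg t).exp
  suffices H : ∀ ε > 0, Real.exp (-t) * |u t| ≤ |u₀| + (∫ s in (0 : ℝ)..t, h s) + ε by
    have := le_of_forall_pos_le_add H
    calc |u t| = Real.exp t * (Real.exp (-t) * |u t|) := by
          rw [← mul_assoc, ← Real.exp_add]; simp
      _ ≤ _ := by gcongr
  intro ε hε
  -- `|u|` need not be differentiable at zeros of `u`; `√(u² + ε²)` is differentiable everywhere,
  -- dominates `|u|`, and costs at most `ε` at time `0`.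
  have hpos (x : ℝ) : 0 < u x ^ 2 + ε ^ 2 := by positivity
  have hq (x : ℝ) := ((((hud x).pow 2).add_const (ε ^ 2)).sqrt (hpos x).ne')
  have hF (x : ℝ) := ((hE x).mul (hq x)).sub (hI x)
  have key := le_of_hasDerivAt_nonpos (T := T) hF (fun x hx ↦ ?_) ht
  · have h0 : √(u 0 ^ 2 + ε ^ 2) ≤ |u₀| + ε := by
      have : u 0 = u₀ := by simp [hu]
      rw [this]
      refine Real.sqrt_le_iff.2 ⟨by positivity, ?_⟩
      nlinarith [sq_abs u₀, abs_nonneg u₀]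
    have h1 : |u t| ≤ √(u t ^ 2 + ε ^ 2) := Real.abs_le_sqrt (by nlinarith)
    have h2 : Real.exp (-t) * |u t| ≤ Real.exp (-t) * √(u t ^ 2 + ε ^ 2) := by gcongr
    simp only [Pi.sub_apply, Pi.mul_apply, intervalIntegral.integral_same, sub_zero, neg_zero,
      Real.exp_zero, one_mul, Pi.pow_apply] at key
    linarith
  · have hx' : x ∈ Set.Icc 0 T := ⟨hx.1.le, hx.2.le⟩
    have h1 := huv x hx'
    set q := √(u x ^ 2 + ε ^ 2) with hqdef
    have hq0 : 0 < q := Real.sqrt_pos.2 (hpos x)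
    have hq1 : |u x| ≤ q := Real.abs_le_sqrt (by nlinarith)
    have h2 : Real.exp (-x) ≤ 1 := Real.exp_le_one_iff.2 (by linarith [hx.1])
    have h3 := Real.exp_pos (-x)
    have h4 := hh0 x
    have h5 : u x * v x / q ≤ q + h x := by
      rw [div_le_iff₀ hq0]
      change u x * v x ≤ |u x| * (|u x| + h x) at h1
      nlinarith [abs_nonneg (u x)]
    have h6 : (↑2 * u x ^ (2 - 1) * v x) / (2 * q) = u x * v x / q := by
      field_simp
      simp [mul_comm]
    simp only [Nat.cast_ofNat, Pi.pow_apply]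
    rw [h6]
    nlinarith

/-- Stability of `y = ξ + ∫ (f(y) - ν) + b` for a one-sided Lipschitz drift `f`. -/
lemma abs_sub_sub_le_of_oneSided {f : ℝ → ℝ} (hf : Continuous f)
    (hone : ∀ a b, (f a - f b) * (a - b) ≤ (a - b) ^ 2)
    {ν₁ ν₂ b₁ b₂ y₁ y₂ : ℝ → ℝ} {ξ₁ ξ₂ T : ℝ} (hν₁ : Continuous ν₁) (hν₂ : Continuous ν₂)
    (hb₁ : Continuous b₁) (hb₂ : Continuous b₂) (hy₁ : Continuous y₁) (hy₂ : Continuous y₂)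
    (h₁ : ∀ t ∈ Set.Icc 0 T, y₁ t = ξ₁ + (∫ s in (0 : ℝ)..t, (f (y₁ s) - ν₁ s)) + b₁ t)
    (h₂ : ∀ t ∈ Set.Icc 0 T, y₂ t = ξ₂ + (∫ s in (0 : ℝ)..t, (f (y₂ s) - ν₂ s)) + b₂ t)
    {t : ℝ} (ht : t ∈ Set.Icc 0 T) :
    |(y₁ t - b₁ t) - (y₂ t - b₂ t)| ≤ Real.exp t * (|ξ₁ - ξ₂| +
      ∫ s in (0 : ℝ)..t, (|f (y₂ s - b₂ s + b₁ s) - f (y₂ s)| + |ν₁ s - ν₂ s|)) := by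
  set v : ℝ → ℝ := fun s ↦ (f (y₁ s) - ν₁ s) - (f (y₂ s) - ν₂ s) with hv
  have hvc : Continuous v := by fun_prop
  have hu : ∀ t ∈ Set.Icc 0 T,
      (y₁ t - b₁ t) - (y₂ t - b₂ t) = (ξ₁ - ξ₂) + ∫ s in (0 : ℝ)..t, v s := by
    intro t ht
    rw [hv, intervalIntegral.integral_sub, h₁ t ht, h₂ t ht]
    · ring
    all_goals exact Continuous.intervalIntegrable (by fun_prop) _ _
  rw [hu t ht]
  refine abs_le_exp_mul_of_mul_le (T := T) hvc (by fun_prop) (fun t ↦ by positivity)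
    (fun s hs ↦ ?_) ht
  rw [← hu s hs]
  set u := (y₁ s - b₁ s) - (y₂ s - b₂ s) with hudef
  -- The noises need not be differentiable, but `u` is. Giving the second solution the noise of the
  -- first turns the difference of positions into `u`, so the one-sided bound applies; the error
  -- made is an increment of `f` along `y₂`.
  have e1 : y₁ s - (y₂ s - b₂ s + b₁ s) = u := by rw [hudef]; ring
  have h3 := hone (y₁ s) (y₂ s - b₂ s + b₁ s)
  rw [e1] at h3
  have h4 : u * (f (y₂ s - b₂ s + b₁ s) - f (y₂ s)) ≤
      |u| * |f (y₂ s - b₂ s + b₁ s) - f (y₂ s)| := by rw [← abs_mul]; exact le_abs_self _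
  have h5 : -(u * (ν₁ s - ν₂ s)) ≤ |u| * |ν₁ s - ν₂ s| := by
    rw [← abs_mul]; exact neg_le_abs _
  have h6 : |u| * |u| = u ^ 2 := by rw [← sq, sq_abs]
  simp only [hv]
  nlinarith

lemma continuous_force : Continuous force := by unfold force; fun_prop

/-- The cubic part contributes `-(a - b)² (a² + ab + b²) ≤ 0`; only the linear part can separate two
solutions. -/
lemma force_oneSided (a b : ℝ) : (force a - force b) * (a - b) ≤ (a - b) ^ 2 := by
  unfold force
  nlinarith [sq_nonneg (a - b), mul_nonneg (sq_nonneg (a - b)) (sq_nonneg (a + b)),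
    mul_nonneg (sq_nonneg (a - b)) (sq_nonneg a), mul_nonneg (sq_nonneg (a - b)) (sq_nonneg b)]

/-- Two solutions with the same noise and different fields. -/
lemma abs_sub_le_of_field {ν₁ ν₂ b y₁ y₂ : ℝ → ℝ} {ξ₁ ξ₂ T : ℝ}
    (hν₁ : Continuous ν₁) (hν₂ : Continuous ν₂)
    (hb : Continuous b) (hy₁ : Continuous y₁) (hy₂ : Continuous y₂)
    (h₁ : ∀ t ∈ Set.Icc 0 T, y₁ t = ξ₁ + (∫ s in (0 : ℝ)..t, (force (y₁ s) - ν₁ s)) + b t)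
    (h₂ : ∀ t ∈ Set.Icc 0 T, y₂ t = ξ₂ + (∫ s in (0 : ℝ)..t, (force (y₂ s) - ν₂ s)) + b t)
    {t : ℝ} (ht : t ∈ Set.Icc 0 T) :
    |y₁ t - y₂ t| ≤ Real.exp t * (|ξ₁ - ξ₂| + ∫ s in (0 : ℝ)..t, |ν₁ s - ν₂ s|) := by
  simpa using abs_sub_sub_le_of_oneSided continuous_force force_oneSided hν₁ hν₂ hb hb hy₁ hy₂
    h₁ h₂ ht

/-- A priori bound: the solution stays close to its noise. -/
lemma abs_sub_noise_le {f : ℝ → ℝ} (hf : Continuous f)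
    (hone : ∀ a b, (f a - f b) * (a - b) ≤ (a - b) ^ 2) {ν b y : ℝ → ℝ} {ξ T : ℝ}
    (hν : Continuous ν) (hb : Continuous b) (hy : Continuous y)
    (h : ∀ t ∈ Set.Icc 0 T, y t = ξ + (∫ s in (0 : ℝ)..t, (f (y s) - ν s)) + b t)
    {t : ℝ} (ht : t ∈ Set.Icc 0 T) :
    |y t - b t| ≤ Real.exp t * (|ξ| + ((∫ s in (0 : ℝ)..t, |f (b s)|) +
      ∫ s in (0 : ℝ)..t, |ν s|)) := by
  -- The noise `b` itself solves the equation with start `0` and field `f ∘ b`, so it can serve as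
  -- the comparison solution.
  have := abs_sub_sub_le_of_oneSided (ν₂ := fun s ↦ f (b s)) (ξ₂ := 0) hf hone hν
    (by fun_prop) hb hb hy hb h (fun t _ ↦ by simp) ht
  simp only [sub_self, sub_zero, zero_add, abs_zero] at this
  refine this.trans ?_
  gcongr
  rw [← intervalIntegral.integral_add]
  · refine intervalIntegral.integral_mono_on ht.1 ?_ ?_ (fun s _ ↦ ?_)
    · exact Continuous.intervalIntegrable (by fun_prop) _ _
    · exact Continuous.intervalIntegrable (by fun_prop) _ _
    · rw [add_comm]; exact abs_sub _ _
  all_goals exact Continuous.intervalIntegrable (by fun_prop) _ _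

/-! ### Existence of solutions, by truncation of the force -/

/-- Only the base point is assumed bounded, not the increment. This gives both the Lipschitz
constant of the truncated force and the continuity of `flow` at a fixed datum. -/
lemma abs_force_sub_le {a δ M : ℝ} (ha : |a| ≤ M) :
    |force (a + δ) - force a| ≤ |δ| * (1 + 3 * M ^ 2 + 3 * M * |δ| + |δ| ^ 2) := by
  have hM : 0 ≤ M := (abs_nonneg a).trans ha
  have e : force (a + δ) - force a = δ * (1 - 3 * a ^ 2 - 3 * a * δ - δ ^ 2) := by
    unfold force; ring
  rw [e, abs_mul]
  gcongr
  have h1 : a ^ 2 ≤ M ^ 2 := sq_le_sq' (by linarith [(abs_le.1 ha).1]) (abs_le.1 ha).2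
  have h2 : |a * δ| ≤ M * |δ| := by rw [abs_mul]; gcongr
  have h3 := abs_le.1 h2
  rw [sq_abs]
  rw [abs_le]
  constructor <;> nlinarith [sq_nonneg a, sq_nonneg δ, h3.1, h3.2]

/-- The force, frozen outside `[-n, n]`. -/
noncomputable def truncForce (n : ℝ) (x : ℝ) : ℝ := force (max (-n) (min n x))

lemma abs_clamp_le {n : ℝ} (hn : 0 ≤ n) (x : ℝ) : |max (-n) (min n x)| ≤ n :=
  abs_le.2 ⟨le_max_left _ _, max_le (by linarith) (min_le_left _ _)⟩

lemma truncForce_eq {n x : ℝ} (h : |x| ≤ n) : truncForce n x = force x := by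
  rw [truncForce, min_eq_right (abs_le.1 h).2, max_eq_right (abs_le.1 h).1]

lemma continuous_truncForce (n : ℝ) : Continuous (truncForce n) := by
  unfold truncForce
  exact continuous_force.comp (by fun_prop)

lemma clamp_sub_clamp {n a b : ℝ} (h : b ≤ a) :
    0 ≤ max (-n) (min n a) - max (-n) (min n b) ∧
      max (-n) (min n a) - max (-n) (min n b) ≤ a - b := by
  constructor
  · rw [sub_nonneg]; gcongr
  · grind

/-- Clamping is monotone and does not increase distances, so the constant `1` survives for every
level `n`. The a priori bound then does not deteriorate as the truncation level grows. -/
lemma truncForce_oneSided (n a b : ℝ) :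
    (truncForce n a - truncForce n b) * (a - b) ≤ (a - b) ^ 2 := by
  wlog h : b ≤ a generalizing a b
  · have := this b a (le_of_not_ge h)
    nlinarith
  obtain ⟨h1, h2⟩ := clamp_sub_clamp (n := n) h
  have h3 := force_oneSided (max (-n) (min n a)) (max (-n) (min n b))
  unfold truncForce
  rcases h1.eq_or_lt with h0 | h0
  · rw [sub_eq_zero.1 h0.symm]; nlinarith
  · have : force (max (-n) (min n a)) - force (max (-n) (min n b)) ≤
        max (-n) (min n a) - max (-n) (min n b) := by
      rw [sq] at h3
      exact le_of_mul_le_mul_right h3 h0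
    nlinarith

lemma abs_truncForce_sub_le {n : ℝ} (hn : 0 ≤ n) (a b : ℝ) :
    |truncForce n a - truncForce n b| ≤ (1 + 3 * n ^ 2 + 3 * n * (2 * n) + (2 * n) ^ 2) *
      |a - b| := by
  have hc : |max (-n) (min n a) - max (-n) (min n b)| ≤ |a - b| := by
    rcases le_total b a with h | h
    · obtain ⟨h1, h2⟩ := clamp_sub_clamp (n := n) h
      rwa [abs_of_nonneg h1, abs_of_nonneg (by linarith)]
    · obtain ⟨h1, h2⟩ := clamp_sub_clamp (n := n) h
      rw [abs_sub_comm, abs_sub_comm a]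
      rwa [abs_of_nonneg h1, abs_of_nonneg (by linarith)]
  have h2n : |max (-n) (min n a) - max (-n) (min n b)| ≤ 2 * n := by
    linarith [abs_sub (max (-n) (min n a)) (max (-n) (min n b)), abs_clamp_le hn a,
      abs_clamp_le hn b]
  have := abs_force_sub_le (δ := max (-n) (min n a) - max (-n) (min n b)) (abs_clamp_le hn b)
  unfold truncForce
  rw [add_sub_cancel] at this
  refine this.trans ?_
  rw [mul_comm]
  gcongr

lemma abs_truncForce_le {n : ℝ} (hn : 0 ≤ n) (x : ℝ) : |truncForce n x| ≤ n ^ 3 + n := by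
  have h := abs_clamp_le hn x
  unfold truncForce force
  calc |-(max (-n) (min n x)) ^ 3 + max (-n) (min n x)|
      ≤ |max (-n) (min n x)| ^ 3 + |max (-n) (min n x)| := by
        refine (abs_add_le _ _).trans ?_
        rw [abs_neg, abs_pow]
    _ ≤ _ := by gcongr

/-- Global solutions for the truncated force. -/
lemma exists_truncated_solution {n : ℝ} (hn : 0 ≤ n) {ν b : ℝ → ℝ} (hν : Continuous ν)
    (hb : Continuous b) (ξ : ℝ) {T : ℝ} (hT : 0 ≤ T) :
    ∃ y : ℝ → ℝ, Continuous y ∧ ∀ t ∈ Set.Icc 0 T,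
      y t = ξ + (∫ s in (0 : ℝ)..t, (truncForce n (y s) - ν s)) + b t := by
  obtain ⟨Kν, hKν⟩ := isCompact_Icc.exists_bound_of_continuousOn
    (hν.continuousOn (s := Set.Icc 0 T))
  have hKν0 : 0 ≤ Kν := (norm_nonneg _).trans (hKν 0 ⟨le_rfl, hT⟩)
  let K : ℝ≥0 := ⟨1 + 3 * n ^ 2 + 3 * n * (2 * n) + (2 * n) ^ 2, by positivity⟩
  let Lb : ℝ≥0 := ⟨n ^ 3 + n + Kν, by positivity⟩
  -- The substitution `z = y - b` removes the noise and leaves an ordinary differential equation.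
  let f : ℝ → ℝ → ℝ := fun t z ↦ truncForce n (z + b t) - ν t
  -- The drift is bounded by `Lb`, so the ball of radius `Lb * T` holds the solution up to time `T`
  -- and a single application covers the whole interval.
  have hPL : IsPicardLindelof f (tmin := 0) (tmax := T) ⟨0, le_rfl, hT⟩ ξ (Lb * ⟨T, hT⟩) 0 Lb K :=
    { lipschitzOnWith := fun t _ ↦ LipschitzWith.lipschitzOnWith
        (LipschitzWith.of_dist_le_mul fun x y ↦ by
          simp only [f, Real.dist_eq]
          have := abs_truncForce_sub_le hn (x + b t) (y + b t)
          rw [add_sub_add_right_eq_sub] at this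
          rwa [sub_sub_sub_cancel_right])
      continuousOn := fun x _ ↦ Continuous.continuousOn
        (((continuous_truncForce n).comp (by fun_prop)).sub hν)
      norm_le := fun t ht x _ ↦ by
        refine (norm_sub_le _ _).trans ?_
        exact add_le_add (abs_truncForce_le hn _) (hKν t ht)
      mul_max_le := by simp [hT]; exact le_rfl }
  obtain ⟨z, hz0, hz⟩ := hPL.exists_eq_forall_mem_Icc_hasDerivWithinAt₀
  have hzc : ContinuousOn z (Set.Icc 0 T) := fun t ht ↦ (hz t ht).continuousWithinAt
  have hze : Continuous (Set.IccExtend hT ((Set.Icc 0 T).domRestrict z)) :=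
    (continuousOn_iff_continuous_domRestrict.1 hzc).Icc_extend'
  have hEq : ∀ t ∈ Set.Icc 0 T, Set.IccExtend hT ((Set.Icc 0 T).domRestrict z) t = z t := fun t ht ↦ by
    rw [Set.IccExtend_of_mem hT _ ht]; rfl
  refine ⟨fun t ↦ Set.IccExtend hT ((Set.Icc 0 T).domRestrict z) t + b t, by fun_prop, fun t ht ↦ ?_⟩
  simp only []
  rw [hEq t ht]
  congr 1
  have e1 : ∫ s in (0 : ℝ)..t,
      (truncForce n (Set.IccExtend hT ((Set.Icc 0 T).domRestrict z) s + b s) - ν s) =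
        ∫ s in (0 : ℝ)..t, f s (z s) := by
    refine intervalIntegral.integral_congr fun s hs ↦ ?_
    rw [Set.uIcc_of_le ht.1] at hs
    simp only [f]
    rw [hEq s ⟨hs.1, hs.2.trans ht.2⟩]
  rw [e1, intervalIntegral.integral_eq_sub_of_hasDeriv_right_of_le ht.1
    (hzc.mono (Set.Icc_subset_Icc_right ht.2)) (f' := fun s ↦ f s (z s))]
  · simp only at hz0
    rw [hz0]; ring
  · intro s hs
    refine ((hz s ⟨hs.1.le, hs.2.le.trans ht.2⟩).hasDerivAt ?_).hasDerivWithinAt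
    exact Icc_mem_nhds hs.1 (hs.2.trans_le ht.2)
  · refine ContinuousOn.intervalIntegrable ?_
    rw [Set.uIcc_of_le ht.1]
    have := hzc.mono (Set.Icc_subset_Icc_right ht.2)
    exact ((continuous_truncForce n).comp_continuousOn (this.add hb.continuousOn)).sub
      hν.continuousOn

/-- Truncate at a level that the a priori bound forbids the truncated solution to exceed: the
truncation is then never felt. -/
lemma exists_solution {ν b : ℝ → ℝ} (hν : Continuous ν) (hb : Continuous b) (ξ : ℝ) {T : ℝ}
    (hT : 0 ≤ T) :
    ∃ y : ℝ → ℝ, Continuous y ∧ ∀ t ∈ Set.Icc 0 T,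
      y t = ξ + (∫ s in (0 : ℝ)..t, (force (y s) - ν s)) + b t := by
  obtain ⟨Kb, hKb⟩ := isCompact_Icc.exists_bound_of_continuousOn
    (hb.continuousOn (s := Set.Icc 0 T))
  have hKb0 : 0 ≤ Kb := (norm_nonneg _).trans (hKb 0 ⟨le_rfl, hT⟩)
  set Z := Real.exp T * (|ξ| + ((∫ s in (0 : ℝ)..T, |force (b s)|) +
      ∫ s in (0 : ℝ)..T, |ν s|)) with hZ
  have hfb : Continuous fun s ↦ |force (b s)| := (continuous_force.comp hb).abs
  have hi {g : ℝ → ℝ} {t : ℝ} (ht : t ∈ Set.Icc 0 T) (hg : Continuous g) (hg0 : ∀ s, 0 ≤ g s) :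
      0 ≤ ∫ s in (0 : ℝ)..t, g s ∧ ∫ s in (0 : ℝ)..t, g s ≤ ∫ s in (0 : ℝ)..T, g s :=
    ⟨intervalIntegral.integral_nonneg ht.1 fun s _ ↦ hg0 s,
      intervalIntegral.integral_mono_interval le_rfl ht.1 ht.2
        (Eventually.of_forall hg0) (hg.intervalIntegrable _ _)⟩
  have hZ0 : 0 ≤ Z := by
    have := (hi (t := T) ⟨hT, le_rfl⟩ hfb fun _ ↦ abs_nonneg _).1
    have := (hi (t := T) ⟨hT, le_rfl⟩ hν.abs fun _ ↦ abs_nonneg _).1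
    positivity
  -- `Z` will bound `y - b` and `Kb` bounds `b`.
  obtain ⟨y, hy, h⟩ := exists_truncated_solution (n := Z + Kb) (by positivity) hν hb ξ hT
  refine ⟨y, hy, fun t ht ↦ ?_⟩
  rw [h t ht]
  congr 2
  refine intervalIntegral.integral_congr fun s hs ↦ ?_
  rw [Set.uIcc_of_le ht.1] at hs
  have hs' : s ∈ Set.Icc 0 T := ⟨hs.1, hs.2.trans ht.2⟩
  rw [truncForce_eq]
  have h1 := abs_sub_noise_le (continuous_truncForce _) (truncForce_oneSided _) hν hb hy h hs'
  -- The a priori bound sees the truncated force only along `b`, which lies below the level. This is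
  -- why `Z` could be fixed beforehand without circularity.
  have e : ∫ r in (0 : ℝ)..s, |truncForce (Z + Kb) (b r)| = ∫ r in (0 : ℝ)..s, |force (b r)| := by
    refine intervalIntegral.integral_congr fun r hr ↦ ?_
    rw [Set.uIcc_of_le hs'.1] at hr
    rw [truncForce_eq]
    exact (hKb r ⟨hr.1, hr.2.trans hs'.2⟩).trans (by linarith)
  rw [e] at h1
  have h2 : |y s - b s| ≤ Z := by
    refine h1.trans ?_
    rw [hZ]
    have a1 := (hi hs' hfb fun _ ↦ abs_nonneg _)
    have a2 := (hi hs' hν.abs fun _ ↦ abs_nonneg _)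
    have a3 := a1.1
    have a4 := a2.1
    gcongr
    · exact hs'.2
    · exact a1.2
    · exact a2.2
  have h3 : |b s| ≤ Kb := hKb s hs'
  calc |y s| = |(y s - b s) + b s| := by ring_nf
    _ ≤ _ := (abs_add_le _ _).trans (add_le_add h2 h3)

section

/-! ### The space of real paths -/

/-- Real continuous paths on `[0, T]`. -/
abbrev RealPath (T : ℝ≥0) := C(Set.Icc (0 : ℝ≥0) T, ℝ)

instance realPathMeasurableSpace (T : ℝ≥0) : MeasurableSpace (RealPath T) := borel _

instance realPathBorelSpace (T : ℝ≥0) : BorelSpace (RealPath T) := ⟨rfl⟩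

/-- The value at a real time of a path on `[0, T]`, extended by constants. -/
noncomputable def pathAt {T : ℝ≥0} (f : RealPath T) (s : ℝ) : ℝ :=
  f (Set.projIcc 0 T zero_le s.toNNReal)

lemma continuous_pathAt {T : ℝ≥0} : Continuous fun p : RealPath T × ℝ ↦ pathAt p.1 p.2 := by
  unfold pathAt
  have : Continuous fun p : RealPath T × ℝ ↦ Set.projIcc 0 T zero_le p.2.toNNReal :=
    continuous_projIcc.comp (continuous_real_toNNReal.comp continuous_snd)
  exact continuous_eval.comp (continuous_fst.prodMk this)

lemma continuous_pathAt_right {T : ℝ≥0} (f : RealPath T) : Continuous (pathAt f) :=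
  continuous_pathAt.comp (by fun_prop : Continuous fun s : ℝ ↦ (f, s))

lemma continuous_pathAt_left {T : ℝ≥0} (s : ℝ) : Continuous fun f : RealPath T ↦ pathAt f s :=
  continuous_pathAt.comp (by fun_prop : Continuous fun f : RealPath T ↦ (f, s))

lemma pathAt_coe {T : ℝ≥0} (f : RealPath T) (t : Set.Icc (0 : ℝ≥0) T) :
    pathAt f ((t : ℝ≥0) : ℝ) = f t := by
  simp [pathAt]

lemma pathAt_of_mem {T : ℝ≥0} (f : RealPath T) {s : ℝ} (hs : s ∈ Set.Icc (0 : ℝ) T) :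
    pathAt f s = f ⟨s.toNNReal, zero_le, Real.toNNReal_le_iff_le_coe.2 hs.2⟩ := by
  rw [pathAt, Set.projIcc_of_mem zero_le ⟨zero_le, Real.toNNReal_le_iff_le_coe.2 hs.2⟩]

lemma abs_pathAt_le {T : ℝ≥0} (f : RealPath T) (s : ℝ) : |pathAt f s| ≤ ‖f‖ :=
  f.norm_coe_le_norm _

lemma pathAt_sub {T : ℝ≥0} (f g : RealPath T) (s : ℝ) :
    pathAt (f - g) s = pathAt f s - pathAt g s := rfl

/-- A dense sequence of times. -/
noncomputable def sampleTime (T : ℝ≥0) : ℕ → Set.Icc (0 : ℝ≥0) T :=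
  haveI : Nonempty (Set.Icc (0 : ℝ≥0) T) := ⟨⟨0, le_rfl, zero_le⟩⟩
  TopologicalSpace.denseSeq _

lemma denseRange_sampleTime (T : ℝ≥0) : DenseRange (sampleTime T) :=
  haveI : Nonempty (Set.Icc (0 : ℝ≥0) T) := ⟨⟨0, le_rfl, zero_le⟩⟩
  TopologicalSpace.denseRange_denseSeq _

/-- Paths depend measurably on their values at countably many times. -/
lemma exists_measurable_interp (T : ℝ≥0) : ∃ g : (ℕ → ℝ) → RealPath T, Measurable g ∧
    ∀ f : RealPath T, g (fun n ↦ f (sampleTime T n)) = f := by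
  have hc : Continuous fun (f : RealPath T) (n : ℕ) ↦ f (sampleTime T n) := by fun_prop
  have hi : Function.Injective fun (f : RealPath T) (n : ℕ) ↦ f (sampleTime T n) := by
    intro f g hfg
    refine DFunLike.coe_injective ?_
    exact (denseRange_sampleTime T).equalizer f.continuous g.continuous hfg
  -- The Lusin–Souslin theorem: a continuous injection of a Polish space has a measurable inverse on
  -- its image.
  have he := hc.measurableEmbedding hi
  exact ⟨he.invFun, he.measurable_invFun, fun f ↦ he.leftInverse_invFun f⟩

/-- The restriction to `[0, T]` of a continuous function, as a measurable map on all functions. -/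
noncomputable def pathOf (T : ℝ≥0) (h : ℝ≥0 → ℝ) : RealPath T :=
  (exists_measurable_interp T).choose fun n ↦ h (sampleTime T n)

lemma measurable_pathOf (T : ℝ≥0) : Measurable (pathOf T) :=
  (exists_measurable_interp T).choose_spec.1.comp (by fun_prop)

lemma pathOf_apply {T : ℝ≥0} {h : ℝ≥0 → ℝ} (hh : Continuous h) (t : Set.Icc (0 : ℝ≥0) T) :
    pathOf T h t = h t := by
  have := (exists_measurable_interp T).choose_spec.2
    ⟨fun t ↦ h t, hh.comp continuous_subtype_val⟩
  exact DFunLike.congr_fun this t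

lemma pathAt_pathOf {T : ℝ≥0} {h : ℝ≥0 → ℝ} (hh : Continuous h) {s : ℝ}
    (hs : s ∈ Set.Icc (0 : ℝ) T) : pathAt (pathOf T h) s = h s.toNNReal := by
  rw [pathAt_of_mem _ hs, pathOf_apply hh]

variable {Ω Ω' : Type*} [MeasurableSpace Ω] [MeasurableSpace Ω']

lemma aemeasurable_pathOf {P : Measure Ω} (T : ℝ≥0) {X : ℝ≥0 → Ω → ℝ}
    (hX : ∀ t, AEMeasurable (X t) P) : AEMeasurable (fun ω ↦ pathOf T fun t ↦ X t ω) P :=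
  (exists_measurable_interp T).choose_spec.1.comp_aemeasurable
    (aemeasurable_pi_lambda _ fun _ ↦ hX _)

/-- Two processes with the same finite-dimensional laws have the same law on path space. -/
lemma map_pathOf_eq {P : Measure Ω} {P' : Measure Ω'} [IsFiniteMeasure P] (T : ℝ≥0)
    {X : ℝ≥0 → Ω → ℝ} {X' : ℝ≥0 → Ω' → ℝ}
    (hX : ∀ t, AEMeasurable (X t) P) (hX' : ∀ t, AEMeasurable (X' t) P')
    (h : ∀ I : Finset ℝ≥0,
      P.map (fun ω ↦ I.restrict (X · ω)) = P'.map (fun ω ↦ I.restrict (X' · ω))) :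
    P.map (fun ω ↦ pathOf T fun t ↦ X t ω) = P'.map (fun ω ↦ pathOf T fun t ↦ X' t ω) := by
  have m1 : AEMeasurable (fun ω (n : ℕ) ↦ X (sampleTime T n) ω) P :=
    aemeasurable_pi_lambda _ fun _ ↦ hX _
  have m2 : AEMeasurable (fun ω (n : ℕ) ↦ X' (sampleTime T n) ω) P' :=
    aemeasurable_pi_lambda _ fun _ ↦ hX' _
  have key : P.map (fun ω (n : ℕ) ↦ X (sampleTime T n) ω) =
      P'.map (fun ω (n : ℕ) ↦ X' (sampleTime T n) ω) := by
    refine (isProjectiveLimit_map (X := fun n ω ↦ X (sampleTime T n) ω) m1).unique ?_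
    have := isProjectiveLimit_map (X := fun n ω ↦ X' (sampleTime T n) ω) m2
    convert this using 2 with I
    -- Sample times may repeat, so the marginal indexed by `I` is obtained from the one at the times
    -- `J` by copying coordinates with `φ`.
    let J : Finset ℝ≥0 := I.image fun n ↦ (sampleTime T n : ℝ≥0)
    let φ : (J → ℝ) → (I → ℝ) := fun z n ↦
      z ⟨sampleTime T n, Finset.mem_image_of_mem (fun n ↦ (sampleTime T n : ℝ≥0)) n.2⟩
    have hφ : Measurable φ := by fun_prop
    have n1 : AEMeasurable (fun ω ↦ J.restrict (X · ω)) P :=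
      aemeasurable_pi_lambda _ fun _ ↦ hX _
    have n2 : AEMeasurable (fun ω ↦ J.restrict (X' · ω)) P' :=
      aemeasurable_pi_lambda _ fun _ ↦ hX' _
    have := congrArg (Measure.map φ) (h J)
    rwa [AEMeasurable.map_map_of_aemeasurable hφ.aemeasurable n1,
      AEMeasurable.map_map_of_aemeasurable hφ.aemeasurable n2] at this
  have hg := (exists_measurable_interp T).choose_spec.1
  have := congrArg (Measure.map (exists_measurable_interp T).choose) key
  rwa [AEMeasurable.map_map_of_aemeasurable hg.aemeasurable m1,
    AEMeasurable.map_map_of_aemeasurable hg.aemeasurable m2] at this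

/-- The joint law of an initial position and an independent Brownian path is unique. -/
lemma map_initial_pathOf_eq {P : Measure Ω} {P' : Measure Ω'} [IsProbabilityMeasure P]
    [IsProbabilityMeasure P'] (T : ℝ≥0) {lam : Measure ℝ} {ξ : Ω → ℝ} {ξ' : Ω' → ℝ}
    {B : ℝ≥0 → Ω → ℝ} {B' : ℝ≥0 → Ω' → ℝ} (hξ : HasLaw ξ lam P) (hξ' : HasLaw ξ' lam P')
    (hB : IsBrownianReal B P) (hB' : IsBrownianReal B' P')
    (h : IndepFun ξ (fun ω t ↦ B t ω) P) (h' : IndepFun ξ' (fun ω t ↦ B' t ω) P') :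
    P.map (fun ω ↦ (ξ ω, pathOf T fun t ↦ B t ω)) =
      P'.map (fun ω ↦ (ξ' ω, pathOf T fun t ↦ B' t ω)) := by
  have m1 := aemeasurable_pathOf T hB.aemeasurable
  have m2 := aemeasurable_pathOf T hB'.aemeasurable
  rw [(indepFun_iff_map_prod_eq_prod_map_map hξ.aemeasurable m1).1
      (h.comp measurable_id (measurable_pathOf T)),
    (indepFun_iff_map_prod_eq_prod_map_map hξ'.aemeasurable m2).1
      (h'.comp measurable_id (measurable_pathOf T)), hξ.map_eq, hξ'.map_eq,
    map_pathOf_eq T hB.aemeasurable hB'.aemeasurable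
      fun I ↦ (hB.hasLaw I).map_eq.trans (hB'.hasLaw I).map_eq.symm]

/-- Pairing two mutually independent families which are independent of each other. -/
lemma iIndepFun_prodMk {ι : Type*} [Fintype ι] {α β : Type*} [MeasurableSpace α]
    [MeasurableSpace β] {P : Measure Ω} [IsProbabilityMeasure P] {X : ι → Ω → α} {Y : ι → Ω → β}
    (mX : ∀ i, AEMeasurable (X i) P) (mY : ∀ i, AEMeasurable (Y i) P)
    (hX : iIndepFun X P) (hY : iIndepFun Y P)
    (hXY : IndepFun (fun ω i ↦ X i ω) (fun ω i ↦ Y i ω) P) :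
    iIndepFun (fun i ω ↦ (X i ω, Y i ω)) P := by
  have pX (i : ι) : IsProbabilityMeasure (P.map (X i)) := Measure.isProbabilityMeasure_map (mX i)
  have pY (i : ι) : IsProbabilityMeasure (P.map (Y i)) := Measure.isProbabilityMeasure_map (mY i)
  have mX' : AEMeasurable (fun ω i ↦ X i ω) P := aemeasurable_pi_lambda _ mX
  have mY' : AEMeasurable (fun ω i ↦ Y i ω) P := aemeasurable_pi_lambda _ mY
  rw [iIndepFun_iff_map_fun_eq_pi_map fun i ↦ (mX i).prodMk (mY i)]
  have h1 (i : ι) : P.map (fun ω ↦ (X i ω, Y i ω)) = (P.map (X i)).prod (P.map (Y i)) :=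
    (indepFun_iff_map_prod_eq_prod_map_map (mX i) (mY i)).1
      (hXY.comp (measurable_pi_apply i) (measurable_pi_apply i))
  simp_rw [h1]
  have h2 := (indepFun_iff_map_prod_eq_prod_map_map mX' mY').1 hXY
  rw [(iIndepFun_iff_map_fun_eq_pi_map mX).1 hX, (iIndepFun_iff_map_fun_eq_pi_map mY).1 hY] at h2
  have mp := measurePreserving_arrowProdEquivProdArrow α β ι (fun i ↦ P.map (X i))
    (fun i ↦ P.map (Y i))
  rw [← (mp.symm _).map_eq, ← h2,
    AEMeasurable.map_map_of_aemeasurable (MeasurableEquiv.measurable _).aemeasurable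
      (mX'.prodMk mY')]
  rfl

/-! ### The solution map -/

lemma exists_flow (T : ℝ≥0) (σ : ℝ) (ν : C(ℝ, ℝ)) (p : ℝ × RealPath T) :
    ∃ y : RealPath T, ∀ t ∈ Set.Icc (0 : ℝ) T,
      pathAt y t = p.1 + (∫ s in (0 : ℝ)..t, (force (pathAt y s) - ν s)) + σ * pathAt p.2 t := by
  obtain ⟨y, hy, h⟩ := exists_solution ν.continuous (b := fun t ↦ σ * pathAt p.2 t)
    ((continuous_pathAt_right p.2).const_mul σ) p.1 T.2
  refine ⟨⟨fun t ↦ y t, hy.comp (by fun_prop)⟩, fun t ht ↦ ?_⟩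
  have e : ∀ s ∈ Set.Icc (0 : ℝ) T,
      pathAt (⟨fun t ↦ y t, hy.comp (by fun_prop)⟩ : RealPath T) s = y s := fun s hs ↦ by
    rw [pathAt_of_mem _ hs]
    simp [hs.1]
  rw [e t ht, h t ht]
  congr 2
  refine intervalIntegral.integral_congr fun s hs ↦ ?_
  rw [Set.uIcc_of_le ht.1] at hs
  simp only [e s ⟨hs.1, hs.2.trans ht.2⟩]

/-- The solution of `dy = (-y³ + y) dt - ν dt + σ dw` on `[0, T]` as a function of the initial
position and of the driving path. -/
noncomputable def flow (T : ℝ≥0) (σ : ℝ) (ν : C(ℝ, ℝ)) (p : ℝ × RealPath T) : RealPath T :=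
  (exists_flow T σ ν p).choose

lemma flow_eq {T : ℝ≥0} {σ : ℝ} {ν : C(ℝ, ℝ)} (p : ℝ × RealPath T) {t : ℝ}
    (ht : t ∈ Set.Icc (0 : ℝ) T) :
    pathAt (flow T σ ν p) t = p.1 +
      (∫ s in (0 : ℝ)..t, (force (pathAt (flow T σ ν p) s) - ν s)) + σ * pathAt p.2 t :=
  (exists_flow T σ ν p).choose_spec t ht

/-- The right-hand side involves the solution at `q` only. With `q` fixed it is continuous in `p`
and vanishes at `p = q`, which is continuity of `flow` at `q`. -/
lemma dist_flow_le {T : ℝ≥0} {σ : ℝ} {ν : C(ℝ, ℝ)} (p q : ℝ × RealPath T) :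
    dist (flow T σ ν p) (flow T σ ν q) ≤ |σ| * ‖p.2 - q.2‖ + Real.exp T * (|p.1 - q.1| +
      T * ((|σ| * ‖p.2 - q.2‖) * (1 + 3 * ‖flow T σ ν q‖ ^ 2 +
        3 * ‖flow T σ ν q‖ * (|σ| * ‖p.2 - q.2‖) + (|σ| * ‖p.2 - q.2‖) ^ 2))) := by
  rw [ContinuousMap.dist_le (by positivity)]
  intro t
  have ht : (t : ℝ) ∈ Set.Icc (0 : ℝ) T := ⟨t.1.2, t.2.2⟩
  rw [← pathAt_coe, ← pathAt_coe (flow T σ ν q), Real.dist_eq]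
  set y₁ := flow T σ ν p
  set y₂ := flow T σ ν q
  have c (f : RealPath T) := continuous_pathAt_right f
  have h := abs_sub_sub_le_of_oneSided continuous_force force_oneSided ν.continuous ν.continuous
    ((c p.2).const_mul σ) ((c q.2).const_mul σ) (c y₁) (c y₂) (fun t ht ↦ flow_eq p ht)
    (fun t ht ↦ flow_eq q ht) ht
  simp only [sub_self, abs_zero, add_zero] at h
  have hw (s : ℝ) : |σ * pathAt p.2 s - σ * pathAt q.2 s| ≤ |σ| * ‖p.2 - q.2‖ := by
    rw [← mul_sub, abs_mul, ← pathAt_sub]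
    gcongr
    exact abs_pathAt_le _ _
  have e : pathAt y₁ t - pathAt y₂ t = (pathAt y₁ t - σ * pathAt p.2 t -
    (pathAt y₂ t - σ * pathAt q.2 t)) + (σ * pathAt p.2 t - σ * pathAt q.2 t) := by ring
  rw [e]
  refine (abs_add_le _ _).trans ?_
  rw [add_comm]
  refine add_le_add (hw t) (h.trans ?_)
  have h0 := intervalIntegral.integral_nonneg (μ := volume) ht.1 fun s _ ↦
    abs_nonneg (force (pathAt y₂ s - σ * pathAt q.2 s + σ * pathAt p.2 s) - force (pathAt y₂ s))
  gcongr
  · exact ht.2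
  · have := intervalIntegral.norm_integral_le_of_norm_le_const (a := 0) (b := (t : ℝ))
      (f := fun s ↦ |force (pathAt y₂ s - σ * pathAt q.2 s + σ * pathAt p.2 s) -
        force (pathAt y₂ s)|) (C := (|σ| * ‖p.2 - q.2‖) * (1 + 3 * ‖y₂‖ ^ 2 +
        3 * ‖y₂‖ * (|σ| * ‖p.2 - q.2‖) + (|σ| * ‖p.2 - q.2‖) ^ 2)) (fun s _ ↦ ?_)
    · refine (le_abs_self _).trans (this.trans ?_)
      rw [sub_zero, abs_of_nonneg ht.1, mul_comm]
      gcongr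
      exact ht.2
    · rw [Real.norm_eq_abs, abs_abs, sub_add_eq_add_sub, add_sub_assoc]
      refine (abs_force_sub_le (abs_pathAt_le y₂ s)).trans ?_
      gcongr <;> exact hw s

lemma continuous_flow (T : ℝ≥0) (σ : ℝ) (ν : C(ℝ, ℝ)) : Continuous (flow T σ ν) := by
  refine continuous_iff_continuousAt.2 fun q ↦ ?_
  rw [ContinuousAt, tendsto_iff_dist_tendsto_zero]
  refine squeeze_zero (fun _ ↦ dist_nonneg) (fun p ↦ dist_flow_le p q) ?_
  refine Continuous.tendsto' (by fun_prop) _ _ (by simp)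

lemma flow_unique {T : ℝ≥0} {σ : ℝ} {ν : C(ℝ, ℝ)} (p : ℝ × RealPath T) {y : ℝ → ℝ}
    (hy : Continuous y) (h : ∀ t ∈ Set.Icc (0 : ℝ) T,
      y t = p.1 + (∫ s in (0 : ℝ)..t, (force (y s) - ν s)) + σ * pathAt p.2 t)
    {t : ℝ} (ht : t ∈ Set.Icc (0 : ℝ) T) : y t = pathAt (flow T σ ν p) t := by
  have := abs_sub_le_of_field ν.continuous ν.continuous ((continuous_pathAt_right p.2).const_mul σ)
    hy (continuous_pathAt_right (flow T σ ν p)) h (fun t ht ↦ flow_eq p ht) ht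
  simpa [sub_eq_zero] using this

end

section

/-! ### Moments of the noise -/

/-- A bound for the `n`-th absolute moment of centered Gaussian laws of variance at most `T`. -/
noncomputable def gaussMoment (T : ℝ≥0) (n : ℕ) : ℝ :=
  √T ^ n * ∫ z, |z| ^ n ∂(gaussianReal 0 1)

lemma integrable_abs_pow_gaussianReal (v : ℝ≥0) (n : ℕ) :
    Integrable (fun x ↦ |x| ^ n) (gaussianReal 0 v) := by
  have := (memLp_id_gaussianReal (μ := 0) (v := v) n).integrable_norm_pow'
  simpa using this

lemma integral_abs_pow_gaussianReal_le {v T : ℝ≥0} (h : v ≤ T) (n : ℕ) :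
    ∫ x, |x| ^ n ∂(gaussianReal 0 v) ≤ gaussMoment T n := by
  have e : gaussianReal 0 v = (gaussianReal 0 1).map (fun x ↦ √v * x) := by
    rw [gaussianReal_map_const_mul]
    congr 1
    · simp
    · ext; simp
  rw [e, integral_map (by fun_prop) (by fun_prop)]
  simp_rw [abs_mul, mul_pow]
  rw [integral_const_mul, gaussMoment]
  have : 0 ≤ ∫ z, |z| ^ n ∂(gaussianReal 0 1) := integral_nonneg fun _ ↦ by positivity
  gcongr
  rw [abs_of_nonneg (Real.sqrt_nonneg _)]
  exact Real.sqrt_le_sqrt (by exact_mod_cast h)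

/-- The first marginal is `lam`, and the second coordinate has the one-dimensional laws of
Brownian motion. -/
structure IsNoiseLaw (T : ℝ≥0) (lam : Measure ℝ) (Q : Measure (ℝ × RealPath T)) : Prop where
  fst : HasLaw Prod.fst lam Q
  eval : ∀ t ∈ Set.Icc (0 : ℝ) T,
    HasLaw (fun p ↦ pathAt p.2 t) (gaussianReal 0 t.toNNReal) Q

/-! ### Exchange of expectation and time integral. -/

section Fubini

variable {α : Type*} [MeasurableSpace α] {Q : Measure α} [IsProbabilityMeasure Q]

lemma integrable_prod_of_bound {g : α → ℝ → ℝ} (hg : Measurable (Function.uncurry g)) {C T : ℝ}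
    (h : ∀ s ∈ Set.Icc 0 T, Integrable (fun p ↦ g p s) Q ∧ ∫ p, |g p s| ∂Q ≤ C) :
    Integrable (Function.uncurry g) (Q.prod (volume.restrict (Set.Ioc 0 T))) := by
  rw [integrable_prod_iff' hg.aestronglyMeasurable]
  constructor
  · refine ae_restrict_of_forall_mem measurableSet_Ioc fun s hs ↦ (h s ⟨hs.1.le, hs.2⟩).1
  · refine Integrable.of_bound ?_ C ?_
    · exact (hg.norm.stronglyMeasurable.integral_prod_left' (μ := Q)).aestronglyMeasurable
    · refine ae_restrict_of_forall_mem measurableSet_Ioc fun s hs ↦ ?_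
      rw [Real.norm_of_nonneg (integral_nonneg fun _ ↦ norm_nonneg _)]
      exact (h s ⟨hs.1.le, hs.2⟩).2

lemma integrable_intervalIntegral_of_bound {g : α → ℝ → ℝ} (hg : Measurable (Function.uncurry g))
    {C T : ℝ} (hT : 0 ≤ T)
    (h : ∀ s ∈ Set.Icc 0 T, Integrable (fun p ↦ g p s) Q ∧ ∫ p, |g p s| ∂Q ≤ C) :
    Integrable (fun p ↦ ∫ s in (0 : ℝ)..T, g p s) Q := by
  simp_rw [intervalIntegral.integral_of_le hT]
  exact (integrable_prod_of_bound hg h).integral_prod_left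

lemma integral_intervalIntegral_of_bound {g : α → ℝ → ℝ} (hg : Measurable (Function.uncurry g))
    {C T : ℝ} (hT : 0 ≤ T)
    (h : ∀ s ∈ Set.Icc 0 T, Integrable (fun p ↦ g p s) Q ∧ ∫ p, |g p s| ∂Q ≤ C) :
    ∫ p, (∫ s in (0 : ℝ)..T, g p s) ∂Q = ∫ s in (0 : ℝ)..T, (∫ p, g p s ∂Q) := by
  simp_rw [intervalIntegral.integral_of_le hT]
  exact integral_integral_swap (integrable_prod_of_bound hg h)

lemma intervalIntegrable_integral_of_bound {g : α → ℝ → ℝ} (hg : Measurable (Function.uncurry g))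
    {C T : ℝ} (hT : 0 ≤ T)
    (h : ∀ s ∈ Set.Icc 0 T, Integrable (fun p ↦ g p s) Q ∧ ∫ p, |g p s| ∂Q ≤ C) :
    IntervalIntegrable (fun s ↦ ∫ p, g p s ∂Q) volume 0 T := by
  rw [intervalIntegrable_iff_integrableOn_Ioc_of_le hT]
  exact (integrable_prod_of_bound hg h).integral_prod_right

end Fubini

lemma add_cube_le {a b : ℝ} (ha : 0 ≤ a) (hb : 0 ≤ b) : (a + b) ^ 3 ≤ 4 * (a ^ 3 + b ^ 3) := by
  nlinarith [mul_nonneg (add_nonneg ha hb) (sq_nonneg (a - b))]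

lemma abs_force_le (x : ℝ) : |force x| ≤ |x| ^ 3 + |x| := by
  unfold force
  refine (abs_add_le _ _).trans ?_
  rw [abs_neg, abs_pow]

/-- Jensen's inequality for the cube. -/
lemma intervalIntegral_cube_le {g : ℝ → ℝ} (hg : Continuous g) (hg0 : ∀ s, 0 ≤ g s) {T : ℝ}
    (hT : 0 ≤ T) :
    (∫ s in (0 : ℝ)..T, g s) ^ 3 ≤ T ^ 2 * ∫ s in (0 : ℝ)..T, g s ^ 3 := by
  rcases hT.eq_or_lt with rfl | hT
  · simp
  set A := ∫ s in (0 : ℝ)..T, g s with hA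
  have hA0 : 0 ≤ A := intervalIntegral.integral_nonneg hT.le fun s _ ↦ hg0 s
  -- `c` is the mean of `g`; the cube lies above its tangent line at `c`.
  set c := A / T
  have hc : 0 ≤ c := by positivity
  have h1 : ∫ s in (0 : ℝ)..T, (3 * c ^ 2 * g s - 2 * c ^ 3) ≤ ∫ s in (0 : ℝ)..T, g s ^ 3 := by
    refine intervalIntegral.integral_mono_on hT.le ?_ ?_ fun s _ ↦ ?_
    · exact Continuous.intervalIntegrable (by fun_prop) _ _
    · exact Continuous.intervalIntegrable (by fun_prop) _ _
    · nlinarith [mul_nonneg (add_nonneg (hg0 s) (add_nonneg hc hc)) (sq_nonneg (g s - c))]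
  rw [intervalIntegral.integral_sub, intervalIntegral.integral_const_mul,
    intervalIntegral.integral_const, ← hA] at h1
  · have h2 : A ^ 3 = T ^ 2 * (3 * c ^ 2 * A - (T - 0) • (2 * c ^ 3)) := by
      simp only [c, smul_eq_mul]; field_simp; ring
    rw [h2]
    gcongr
  all_goals exact Continuous.intervalIntegrable (by fun_prop) _ _

/-- The size of the data of the equation. -/
noncomputable def noiseSize (T : ℝ≥0) (σ : ℝ) (p : ℝ × RealPath T) : ℝ :=
  |p.1| + ∫ s in (0 : ℝ)..T, |force (σ * pathAt p.2 s)|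

/-- A bound for the third moment of `noiseSize`. -/
noncomputable def noiseMoment (T : ℝ≥0) (σ : ℝ) (lam : Measure ℝ) : ℝ :=
  4 * ((∫ r, |r| ^ 3 ∂lam) + T ^ 2 * (T * (4 * (|σ| ^ 9 * gaussMoment T 9 +
    |σ| ^ 3 * gaussMoment T 3))))

variable {T : ℝ≥0} {lam : Measure ℝ} {Q : Measure (ℝ × RealPath T)}

lemma IsNoiseLaw.isProbabilityMeasure [IsProbabilityMeasure lam] (hQ : IsNoiseLaw T lam Q) :
    IsProbabilityMeasure Q := hQ.fst.isProbabilityMeasure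

lemma IsNoiseLaw.integrable_abs_pow (hQ : IsNoiseLaw T lam Q) {t : ℝ}
    (ht : t ∈ Set.Icc (0 : ℝ) T) (n : ℕ) : Integrable (fun p ↦ |pathAt p.2 t| ^ n) Q := by
  have h := hQ.eval t ht
  have := integrable_abs_pow_gaussianReal t.toNNReal n
  rw [← h.map_eq] at this
  exact this.comp_aemeasurable h.aemeasurable

lemma IsNoiseLaw.integral_abs_pow_le (hQ : IsNoiseLaw T lam Q) {t : ℝ}
    (ht : t ∈ Set.Icc (0 : ℝ) T) (n : ℕ) : ∫ p, |pathAt p.2 t| ^ n ∂Q ≤ gaussMoment T n := by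
  have h := (hQ.eval t ht).integral_comp (f := fun x : ℝ ↦ |x| ^ n) (by fun_prop)
  refine (h.le).trans ?_
  exact integral_abs_pow_gaussianReal_le (Real.toNNReal_le_iff_le_coe.2 ht.2) n

lemma IsNoiseLaw.integral_eval (hQ : IsNoiseLaw T lam Q) {t : ℝ}
    (ht : t ∈ Set.Icc (0 : ℝ) T) : ∫ p, pathAt p.2 t ∂Q = 0 := by
  rw [(hQ.eval t ht).integral_eq, integral_id_gaussianReal]

lemma measurable_force_noise (T : ℝ≥0) (σ : ℝ) :
    Measurable (Function.uncurry fun (p : ℝ × RealPath T) (s : ℝ) ↦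
      |force (σ * pathAt p.2 s)|) := by
  have : Continuous fun q : (ℝ × RealPath T) × ℝ ↦ pathAt q.1.2 q.2 :=
    continuous_pathAt.comp (by fun_prop : Continuous fun q : (ℝ × RealPath T) × ℝ ↦ (q.1.2, q.2))
  exact (continuous_force.comp (this.const_mul σ)).abs.measurable

lemma abs_force_mul_cube_le (σ x : ℝ) :
    |force (σ * x)| ^ 3 ≤ 4 * (|σ| ^ 9 * |x| ^ 9 + |σ| ^ 3 * |x| ^ 3) := by
  calc |force (σ * x)| ^ 3 ≤ (|σ * x| ^ 3 + |σ * x|) ^ 3 := by gcongr; exact abs_force_le _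
    _ ≤ 4 * ((|σ * x| ^ 3) ^ 3 + |σ * x| ^ 3) := add_cube_le (by positivity) (by positivity)
    _ = _ := by rw [abs_mul]; ring

/-- The ninth powers are those of a Gaussian variable, so they put no condition on the initial law:
only the initial position limits the available moments to three. -/
lemma IsNoiseLaw.integrable_force_cube (hQ : IsNoiseLaw T lam Q) (σ : ℝ) {s : ℝ}
    (hs : s ∈ Set.Icc (0 : ℝ) T) :
    Integrable (fun p ↦ |force (σ * pathAt p.2 s)| ^ 3) Q ∧
      ∫ p, |(|force (σ * pathAt p.2 s)| ^ 3)| ∂Q ≤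
        4 * (|σ| ^ 9 * gaussMoment T 9 + |σ| ^ 3 * gaussMoment T 3) := by
  have hi : Integrable (fun p : ℝ × RealPath T ↦
      4 * (|σ| ^ 9 * |pathAt p.2 s| ^ 9 + |σ| ^ 3 * |pathAt p.2 s| ^ 3)) Q :=
    (((hQ.integrable_abs_pow hs 9).const_mul _).add
      ((hQ.integrable_abs_pow hs 3).const_mul _)).const_mul _
  have hm : Measurable fun p : ℝ × RealPath T ↦ |force (σ * pathAt p.2 s)| ^ 3 :=
    ((measurable_force_noise T σ).comp (by fun_prop : Measurable fun p : ℝ × RealPath T ↦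
      (p, s))).pow_const 3
  have hle (p : ℝ × RealPath T) := abs_force_mul_cube_le σ (pathAt p.2 s)
  refine ⟨hi.mono' hm.aestronglyMeasurable (ae_of_all _ fun p ↦ ?_), ?_⟩
  · rw [Real.norm_of_nonneg (by positivity)]; exact hle p
  · refine (integral_mono_of_nonneg (ae_of_all _ fun _ ↦ abs_nonneg _) hi
      (ae_of_all _ fun p ↦ ?_)).trans ?_
    · beta_reduce; rw [abs_of_nonneg (by positivity)]; exact hle p
    · rw [integral_const_mul, integral_add, integral_const_mul, integral_const_mul]
      · gcongr
        · exact hQ.integral_abs_pow_le hs 9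
        · exact hQ.integral_abs_pow_le hs 3
      · exact (hQ.integrable_abs_pow hs 9).const_mul _
      · exact (hQ.integrable_abs_pow hs 3).const_mul _

lemma noiseSize_nonneg (σ : ℝ) (p : ℝ × RealPath T) : 0 ≤ noiseSize T σ p := by
  have := intervalIntegral.integral_nonneg (μ := volume) T.coe_nonneg fun s _ ↦
    abs_nonneg (force (σ * pathAt p.2 s))
  unfold noiseSize
  positivity

lemma measurable_noiseSize (σ : ℝ) : Measurable (noiseSize T σ) := by
  unfold noiseSize
  simp_rw [intervalIntegral.integral_of_le T.coe_nonneg]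
  have := (measurable_force_noise T σ).stronglyMeasurable.integral_prod_right
    (ν := volume.restrict (Set.Ioc (0 : ℝ) T))
  exact (by fun_prop : Measurable fun p : ℝ × RealPath T ↦ |p.1|).add this.measurable

lemma IsNoiseLaw.noiseSize_cube [IsProbabilityMeasure lam] (hQ : IsNoiseLaw T lam Q) (σ : ℝ)
    (hlam : Integrable (fun r : ℝ ↦ |r| ^ 3) lam) :
    Integrable (fun p ↦ noiseSize T σ p ^ 3) Q ∧
      ∫ p, noiseSize T σ p ^ 3 ∂Q ≤ noiseMoment T σ lam := by
  have := hQ.isProbabilityMeasure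
  have hb := fun s (hs : s ∈ Set.Icc (0 : ℝ) T) ↦ hQ.integrable_force_cube σ hs
  have hm : Measurable (Function.uncurry fun (p : ℝ × RealPath T) (s : ℝ) ↦
      |force (σ * pathAt p.2 s)| ^ 3) := (measurable_force_noise T σ).pow_const 3
  have i1 : Integrable (fun p : ℝ × RealPath T ↦ |p.1| ^ 3) Q := by
    rw [← hQ.fst.map_eq] at hlam
    exact hlam.comp_aemeasurable hQ.fst.aemeasurable
  have e1 : ∫ p : ℝ × RealPath T, |p.1| ^ 3 ∂Q = ∫ r, |r| ^ 3 ∂lam :=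
    hQ.fst.integral_comp (f := fun x : ℝ ↦ |x| ^ 3) (by fun_prop)
  have i2 := integrable_intervalIntegral_of_bound hm T.coe_nonneg hb
  have e2 := integral_intervalIntegral_of_bound hm T.coe_nonneg hb
  have hi : Integrable (fun p : ℝ × RealPath T ↦
      4 * (|p.1| ^ 3 + (T : ℝ) ^ 2 * ∫ s in (0 : ℝ)..T, |force (σ * pathAt p.2 s)| ^ 3)) Q :=
    (i1.add (i2.const_mul _)).const_mul _
  have hle (p : ℝ × RealPath T) : noiseSize T σ p ^ 3 ≤
      4 * (|p.1| ^ 3 + (T : ℝ) ^ 2 * ∫ s in (0 : ℝ)..T, |force (σ * pathAt p.2 s)| ^ 3) := by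
    have hc : Continuous fun s ↦ |force (σ * pathAt p.2 s)| :=
      (continuous_force.comp ((continuous_pathAt_right p.2).const_mul σ)).abs
    refine (add_cube_le (abs_nonneg _)
      (intervalIntegral.integral_nonneg T.coe_nonneg fun s _ ↦ abs_nonneg _)).trans ?_
    gcongr
    exact intervalIntegral_cube_le hc (fun _ ↦ abs_nonneg _) T.coe_nonneg
  refine ⟨hi.mono' ((measurable_noiseSize σ).pow_const 3).aestronglyMeasurable
    (ae_of_all _ fun p ↦ ?_), ?_⟩
  · rw [Real.norm_of_nonneg (pow_nonneg (noiseSize_nonneg σ p) 3)]; exact hle p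
  · refine (integral_mono_of_nonneg (ae_of_all _ fun p ↦ pow_nonneg (noiseSize_nonneg σ p) 3) hi
      (ae_of_all _ hle)).trans ?_
    rw [integral_const_mul, integral_add i1 (i2.const_mul _), integral_const_mul, e1, e2,
      noiseMoment]
    gcongr
    have h3 := intervalIntegral.integral_mono_on T.coe_nonneg
      (intervalIntegrable_integral_of_bound hm T.coe_nonneg hb)
      (intervalIntegrable_const (c := 4 * (|σ| ^ 9 * gaussMoment T 9 + |σ| ^ 3 * gaussMoment T 3)))
      (fun s hs ↦ ?_)
    · refine h3.trans ?_
      rw [intervalIntegral.integral_const, sub_zero, smul_eq_mul]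
    · refine le_trans (integral_mono (hb s hs).1 (hb s hs).1.abs fun p ↦ le_abs_self _) (hb s hs).2

lemma IsNoiseLaw.noiseSize_first [IsProbabilityMeasure lam] (hQ : IsNoiseLaw T lam Q) (σ : ℝ)
    (hlam : Integrable (fun r : ℝ ↦ |r| ^ 3) lam) :
    Integrable (noiseSize T σ) Q ∧ ∫ p, noiseSize T σ p ∂Q ≤ 1 + noiseMoment T σ lam := by
  have := hQ.isProbabilityMeasure
  obtain ⟨h1, h2⟩ := hQ.noiseSize_cube σ hlam
  have hle (p : ℝ × RealPath T) : noiseSize T σ p ≤ 1 + noiseSize T σ p ^ 3 := by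
    have := noiseSize_nonneg σ p
    nlinarith [sq_nonneg (noiseSize T σ p - 1), mul_nonneg this (sq_nonneg (noiseSize T σ p - 1))]
  have hi := (integrable_const (μ := Q) (1 : ℝ)).add h1
  have hI : Integrable (noiseSize T σ) Q :=
    hi.mono' (measurable_noiseSize σ).aestronglyMeasurable (ae_of_all _ fun p ↦ by
      rw [Real.norm_of_nonneg (noiseSize_nonneg σ p)]; exact hle p)
  refine ⟨hI, (integral_mono hI hi hle).trans ?_⟩
  simp only [Pi.add_apply]
  rw [integral_add (integrable_const _) h1]
  simpa using h2

/-! ### Moments of the flow -/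

/-- The noise part is enlarged to `[0, T]`, but the integral of the field stops at `t`, as
Gronwall's inequality for the mean field requires. -/
lemma abs_flow_sub_le (σ : ℝ) (ν : C(ℝ, ℝ)) (p : ℝ × RealPath T) {t : ℝ}
    (ht : t ∈ Set.Icc (0 : ℝ) T) :
    |pathAt (flow T σ ν p) t - σ * pathAt p.2 t| ≤
      Real.exp T * (noiseSize T σ p + ∫ s in (0 : ℝ)..t, |ν s|) := by
  have hw : Continuous fun t ↦ σ * pathAt p.2 t := (continuous_pathAt_right p.2).const_mul σ
  have hc : Continuous fun s ↦ |force (σ * pathAt p.2 s)| := (continuous_force.comp hw).abs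
  refine (abs_sub_noise_le continuous_force force_oneSided ν.continuous hw
    (continuous_pathAt_right (flow T σ ν p)) (fun t ht ↦ flow_eq p ht) ht).trans ?_
  have a1 := intervalIntegral.integral_nonneg (μ := volume) ht.1 fun s _ ↦ abs_nonneg (ν s)
  have a2 := intervalIntegral.integral_nonneg (μ := volume) ht.1 fun s _ ↦
    abs_nonneg (force (σ * pathAt p.2 s))
  unfold noiseSize
  rw [← add_assoc]
  gcongr
  · exact ht.2
  · exact intervalIntegral.integral_mono_interval le_rfl ht.1 ht.2
      (Eventually.of_forall fun _ ↦ abs_nonneg _) (hc.intervalIntegrable _ _)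

lemma continuous_flow_at (T : ℝ≥0) (σ : ℝ) (ν : C(ℝ, ℝ)) :
    Continuous fun q : (ℝ × RealPath T) × ℝ ↦ pathAt (flow T σ ν q.1) q.2 :=
  continuous_pathAt.comp (((continuous_flow T σ ν).comp continuous_fst).prodMk continuous_snd)

lemma measurable_flow_at (T : ℝ≥0) (σ : ℝ) (ν : C(ℝ, ℝ)) (t : ℝ) :
    Measurable fun p : ℝ × RealPath T ↦ pathAt (flow T σ ν p) t :=
  ((continuous_flow_at T σ ν).comp (by fun_prop : Continuous fun p : ℝ × RealPath T ↦
    (p, t))).measurable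

/-- A bound for the third moment of the flow driven by a field of integral at most `K`. -/
noncomputable def flowMoment (T : ℝ≥0) (σ : ℝ) (lam : Measure ℝ) (K : ℝ) : ℝ :=
  4 * (Real.exp T ^ 3 * (4 * (noiseMoment T σ lam + K ^ 3)) + |σ| ^ 3 * gaussMoment T 3)

/-- The field enters the bound only through `K`, so a bound on its integral by the data makes the
moments uniform over all mean fields. -/
lemma IsNoiseLaw.flow_cube [IsProbabilityMeasure lam] (hQ : IsNoiseLaw T lam Q) (σ : ℝ)
    (hlam : Integrable (fun r : ℝ ↦ |r| ^ 3) lam) (ν : C(ℝ, ℝ)) {K : ℝ}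
    (hK : ∫ s in (0 : ℝ)..T, |ν s| ≤ K) {t : ℝ} (ht : t ∈ Set.Icc (0 : ℝ) T) :
    Integrable (fun p ↦ |pathAt (flow T σ ν p) t| ^ 3) Q ∧
      ∫ p, |pathAt (flow T σ ν p) t| ^ 3 ∂Q ≤ flowMoment T σ lam K := by
  have := hQ.isProbabilityMeasure
  obtain ⟨h1, h2⟩ := hQ.noiseSize_cube σ hlam
  have hν : ∫ s in (0 : ℝ)..t, |ν s| ≤ K :=
    (intervalIntegral.integral_mono_interval le_rfl ht.1 ht.2
      (Eventually.of_forall fun _ ↦ abs_nonneg _)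
      (ν.continuous.abs.intervalIntegrable _ _)).trans hK
  have hK0 : 0 ≤ K := (intervalIntegral.integral_nonneg T.coe_nonneg fun s _ ↦ abs_nonneg _).trans hK
  have i1 : Integrable (fun p ↦ 4 * (noiseSize T σ p ^ 3 + K ^ 3)) Q :=
    (h1.add (integrable_const _)).const_mul _
  have i2 := hQ.integrable_abs_pow ht 3
  have hi : Integrable (fun p : ℝ × RealPath T ↦
      4 * (Real.exp T ^ 3 * (4 * (noiseSize T σ p ^ 3 + K ^ 3)) +
        |σ| ^ 3 * |pathAt p.2 t| ^ 3)) Q :=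
    ((i1.const_mul _).add (i2.const_mul _)).const_mul _
  have hle (p : ℝ × RealPath T) : |pathAt (flow T σ ν p) t| ^ 3 ≤
      4 * (Real.exp T ^ 3 * (4 * (noiseSize T σ p ^ 3 + K ^ 3)) +
        |σ| ^ 3 * |pathAt p.2 t| ^ 3) := by
    have hS := noiseSize_nonneg σ p
    have h3 : |pathAt (flow T σ ν p) t| ≤
        Real.exp T * (noiseSize T σ p + K) + |σ| * |pathAt p.2 t| := by
      have := abs_flow_sub_le σ ν p ht
      rw [← abs_mul]
      calc |pathAt (flow T σ ν p) t|
          = |(pathAt (flow T σ ν p) t - σ * pathAt p.2 t) + σ * pathAt p.2 t| := by ring_nf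
        _ ≤ _ := abs_add_le _ _
        _ ≤ _ := by gcongr; exact this.trans (by gcongr)
    calc |pathAt (flow T σ ν p) t| ^ 3
        ≤ (Real.exp T * (noiseSize T σ p + K) + |σ| * |pathAt p.2 t|) ^ 3 := by gcongr
      _ ≤ 4 * ((Real.exp T * (noiseSize T σ p + K)) ^ 3 + (|σ| * |pathAt p.2 t|) ^ 3) :=
          add_cube_le (by positivity) (by positivity)
      _ ≤ _ := by
          rw [mul_pow, mul_pow]
          gcongr
          exact add_cube_le hS hK0
  refine ⟨hi.mono' ((measurable_flow_at T σ ν t).abs.pow_const 3).aestronglyMeasurable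
    (ae_of_all _ fun p ↦ ?_), ?_⟩
  · rw [Real.norm_of_nonneg (by positivity)]; exact hle p
  · refine (integral_mono_of_nonneg (ae_of_all _ fun p ↦ by positivity) hi
      (ae_of_all _ hle)).trans ?_
    rw [integral_const_mul, integral_add (i1.const_mul _) (i2.const_mul _), integral_const_mul,
      integral_const_mul, integral_const_mul, integral_add h1 (integrable_const _), flowMoment]
    simp only [integral_const, probReal_univ, smul_eq_mul, one_mul]
    gcongr
    exact hQ.integral_abs_pow_le ht 3

lemma IsNoiseLaw.flow_memLp_two [IsProbabilityMeasure lam] (hQ : IsNoiseLaw T lam Q) (σ : ℝ)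
    (hlam : Integrable (fun r : ℝ ↦ |r| ^ 3) lam) (ν : C(ℝ, ℝ)) {K : ℝ}
    (hK : ∫ s in (0 : ℝ)..T, |ν s| ≤ K) {t : ℝ} (ht : t ∈ Set.Icc (0 : ℝ) T) :
    MemLp (fun p ↦ pathAt (flow T σ ν p) t) 2 Q ∧
      ∫ p, pathAt (flow T σ ν p) t ^ 2 ∂Q ≤ 1 + flowMoment T σ lam K := by
  have := hQ.isProbabilityMeasure
  obtain ⟨h1, h2⟩ := hQ.flow_cube σ hlam ν hK ht
  have hle (x : ℝ) : x ^ 2 ≤ 1 + |x| ^ 3 := by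
    rw [← sq_abs]
    have := abs_nonneg x
    nlinarith [sq_nonneg (|x| - 1), mul_nonneg this (sq_nonneg (|x| - 1))]
  have hi := (integrable_const (μ := Q) (1 : ℝ)).add h1
  have hm := measurable_flow_at T σ ν t
  have hI : Integrable (fun p ↦ pathAt (flow T σ ν p) t ^ 2) Q :=
    hi.mono' (hm.pow_const 2).aestronglyMeasurable (ae_of_all _ fun p ↦ by
      rw [Real.norm_of_nonneg (sq_nonneg _)]; exact hle _)
  refine ⟨(memLp_two_iff_integrable_sq hm.aestronglyMeasurable).2 hI,
    (integral_mono hI hi fun p ↦ hle _).trans ?_⟩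
  simp only [Pi.add_apply]
  rw [integral_add (integrable_const _) h1]
  simpa using h2

/-- Third moments match the cubic growth of the force. The constant may depend on `ν`: it serves to
justify Fubini's theorem and does not enter the coupling constant. -/
lemma IsNoiseLaw.flow_force [IsProbabilityMeasure lam] (hQ : IsNoiseLaw T lam Q) (σ : ℝ)
    (hlam : Integrable (fun r : ℝ ↦ |r| ^ 3) lam) (ν : C(ℝ, ℝ)) :
    ∃ C, ∀ t ∈ Set.Icc (0 : ℝ) T, Integrable (fun p ↦ force (pathAt (flow T σ ν p) t)) Q ∧
      ∫ p, |force (pathAt (flow T σ ν p) t)| ∂Q ≤ C := by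
  have := hQ.isProbabilityMeasure
  refine ⟨2 * flowMoment T σ lam (∫ s in (0 : ℝ)..T, |ν s|) + 1, fun t ht ↦ ?_⟩
  obtain ⟨h1, h2⟩ := hQ.flow_cube σ hlam ν le_rfl ht
  have hle (x : ℝ) : |force x| ≤ 2 * |x| ^ 3 + 1 := by
    refine (abs_force_le x).trans ?_
    have := abs_nonneg x
    nlinarith [sq_nonneg (|x| - 1), mul_nonneg this (sq_nonneg (|x| - 1))]
  have hi := (h1.const_mul 2).add (integrable_const (μ := Q) (1 : ℝ))
  have hI : Integrable (fun p ↦ force (pathAt (flow T σ ν p) t)) Q :=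
    hi.mono' (continuous_force.measurable.comp (measurable_flow_at T σ ν t)).aestronglyMeasurable
      (ae_of_all _ fun p ↦ hle _)
  refine ⟨hI, (integral_mono hI.abs hi fun p ↦ hle _).trans ?_⟩
  simp only [Pi.add_apply]
  rw [integral_add (h1.const_mul 2) (integrable_const _), integral_const_mul]
  simpa using h2

/-! ### The mean-field equation -/

/-- The equation of the field of the limit, integrated in time. -/
def IsMeanField (T : ℝ≥0) (α θ σ μ₀ : ℝ) (Q : Measure (ℝ × RealPath T)) (ν : C(ℝ, ℝ)) : Prop :=
  ∀ t ∈ Set.Icc (0 : ℝ) T, ν t + θ * ∫ p, pathAt (flow T σ ν p) t ∂Q =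
    μ₀ + θ * (∫ p, p.1 ∂Q) - α * ∫ s in (0 : ℝ)..t, ν s

/-- A bound for the integral of the modulus of a mean field on `[0, T]`. -/
noncomputable def fieldBound (T : ℝ≥0) (α θ σ μ₀ : ℝ) (lam : Measure ℝ) : ℝ :=
  Real.exp ((θ * Real.exp T + α) * T) * (T * (|μ₀| + θ * (1 + noiseMoment T σ lam) +
    θ * (Real.exp T * (1 + noiseMoment T σ lam))))

/-- The noise has mean zero, so it can be subtracted under the expectation before the pathwise bound
is used. -/
lemma abs_integral_flow_le [IsProbabilityMeasure lam] (hQ : IsNoiseLaw T lam Q) (σ : ℝ)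
    (hlam : Integrable (fun r : ℝ ↦ |r| ^ 3) lam) (ν : C(ℝ, ℝ)) {t : ℝ}
    (ht : t ∈ Set.Icc (0 : ℝ) T) :
    |∫ p, pathAt (flow T σ ν p) t ∂Q| ≤
      Real.exp T * (1 + noiseMoment T σ lam + ∫ s in (0 : ℝ)..t, |ν s|) := by
  have := hQ.isProbabilityMeasure
  obtain ⟨h1, h2⟩ := hQ.noiseSize_first σ hlam
  have hF := (hQ.flow_memLp_two σ hlam ν le_rfl ht).1.integrable one_le_two
  have hW : Integrable (fun p ↦ σ * pathAt p.2 t) Q := by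
    refine Integrable.const_mul ?_ σ
    have := hQ.integrable_abs_pow ht 1
    simp only [pow_one] at this
    exact (integrable_norm_iff (hQ.eval t ht).aemeasurable.aestronglyMeasurable).1 this
  have e : ∫ p, pathAt (flow T σ ν p) t ∂Q =
      ∫ p, (pathAt (flow T σ ν p) t - σ * pathAt p.2 t) ∂Q := by
    rw [integral_sub hF hW, integral_const_mul, hQ.integral_eval ht]; ring
  rw [e]
  refine (abs_integral_le_integral_abs).trans ?_
  refine (integral_mono (hF.sub hW).abs ((h1.add (integrable_const _)).const_mul _)
    fun p ↦ abs_flow_sub_le σ ν p ht).trans ?_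
  simp only [Pi.add_apply]
  rw [integral_const_mul, integral_add h1 (integrable_const _)]
  simp only [integral_const, probReal_univ, smul_eq_mul, one_mul]
  gcongr

/-- The expectation of the flow is bounded affinely in `∫ |ν|`, so the mean-field identity closes
under Gronwall's inequality. The cubic term never appears, because the identity is written for `ν +
θ E y`. -/
lemma IsMeanField.integral_abs_le [IsProbabilityMeasure lam] {α θ σ μ₀ : ℝ} (hα : 0 ≤ α)
    (hθ : 0 < θ) (hQ : IsNoiseLaw T lam Q) (hlam : Integrable (fun r : ℝ ↦ |r| ^ 3) lam)
    {ν : C(ℝ, ℝ)} (hν : IsMeanField T α θ σ μ₀ Q ν) :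
    ∫ s in (0 : ℝ)..T, |ν s| ≤ fieldBound T α θ σ μ₀ lam := by
  have := hQ.isProbabilityMeasure
  obtain ⟨h1, h2⟩ := hQ.noiseSize_first σ hlam
  have hM : 0 ≤ 1 + noiseMoment T σ lam :=
    (integral_nonneg fun p ↦ noiseSize_nonneg σ p).trans h2
  have hξ : |∫ p, p.1 ∂Q| ≤ 1 + noiseMoment T σ lam := by
    refine (abs_integral_le_integral_abs).trans ((integral_mono_of_nonneg
      (ae_of_all _ fun _ ↦ abs_nonneg _) h1 (ae_of_all _ fun p ↦ ?_)).trans h2)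
    have := intervalIntegral.integral_nonneg (μ := volume) T.coe_nonneg fun s _ ↦
      abs_nonneg (force (σ * pathAt p.2 s))
    simpa [noiseSize] using this
  have key := integral_abs_le_of_abs_le_integral (e := ν)
    (R := fun _ ↦ |μ₀| + θ * (1 + noiseMoment T σ lam) +
      θ * (Real.exp T * (1 + noiseMoment T σ lam))) (L := θ * Real.exp T + α)
    ν.continuous continuous_const (fun _ ↦ by positivity) (by positivity) T.coe_nonneg (fun t ht ↦ ?_)
  · rw [intervalIntegral.integral_const, sub_zero, smul_eq_mul] at key
    exact key
  · have e1 := hν t ht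
    have h3 := abs_integral_flow_le hQ σ hlam ν ht
    have h4 : |∫ s in (0 : ℝ)..t, ν s| ≤ ∫ s in (0 : ℝ)..t, |ν s| :=
      intervalIntegral.abs_integral_le_integral_abs ht.1
    have e2 : ν t = μ₀ + θ * (∫ p, p.1 ∂Q) + -(θ * ∫ p, pathAt (flow T σ ν p) t ∂Q)
        + -(α * ∫ s in (0 : ℝ)..t, ν s) := by linarith
    rw [e2]
    refine (abs_add_le _ _).trans ?_
    rw [abs_neg, abs_mul, abs_of_nonneg hα]
    have h5 : α * |∫ s in (0 : ℝ)..t, ν s| ≤ α * ∫ s in (0 : ℝ)..t, |ν s| := by gcongr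
    have h6 : θ * |∫ p, p.1 ∂Q| ≤ θ * (1 + noiseMoment T σ lam) := by gcongr
    have h7 : θ * |∫ p, pathAt (flow T σ ν p) t ∂Q| ≤
      θ * (Real.exp T * (1 + noiseMoment T σ lam + ∫ s in (0 : ℝ)..t, |ν s|)) := by gcongr
    have h8 : |μ₀ + θ * (∫ p, p.1 ∂Q) + -(θ * ∫ p, pathAt (flow T σ ν p) t ∂Q)| ≤
        |μ₀| + θ * |∫ p, p.1 ∂Q| + θ * |∫ p, pathAt (flow T σ ν p) t ∂Q| := by
      refine (abs_add_le _ _).trans ?_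
      rw [abs_neg, abs_mul, abs_of_pos hθ]
      gcongr
      refine (abs_add_le _ _).trans ?_
      rw [abs_mul, abs_of_pos hθ]
    linarith

/-- A bound for the second moment of the limit process. -/
noncomputable def limitMoment (T : ℝ≥0) (α θ σ μ₀ : ℝ) (lam : Measure ℝ) : ℝ :=
  1 + flowMoment T σ lam (fieldBound T α θ σ μ₀ lam)

end

/-! ### Solutions of the limit equation as images of the flow. -/

section

/-- A solution of the integral equation is given by the flow. -/
lemma eq_flow_of_integral_eq (T : ℝ≥0) {σ ξ : ℝ} {ν : C(ℝ, ℝ)} {b y : ℝ≥0 → ℝ}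
    (hb : Continuous b) (hy : Continuous y)
    (h : ∀ t : ℝ≥0, y t = ξ + (∫ s in (0 : ℝ)..t, (force (y s.toNNReal) - ν s)) + σ * b t)
    {t : ℝ≥0} (ht : t ≤ T) : y t = pathAt (flow T σ ν (ξ, pathOf T b)) t := by
  have := flow_unique (σ := σ) (ν := ν) (ξ, pathOf T b) (y := fun s ↦ y s.toNNReal)
    (hy.comp continuous_real_toNNReal) (fun t ht ↦ ?_) (t := t) ⟨t.coe_nonneg, by exact_mod_cast ht⟩
  · simpa using this
  · have h1 := h t.toNNReal
    rw [Real.coe_toNNReal _ ht.1] at h1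
    rw [h1]
    congr 2
    exact (pathAt_pathOf hb ht).symm

variable {Ω : Type*} [MeasurableSpace Ω] {P : Measure Ω}

/-- The initial position together with the path of the noise on `[0, T]`. -/
noncomputable def initialNoise (T : ℝ≥0) (ξ : Ω → ℝ) (B : ℝ≥0 → Ω → ℝ) (ω : Ω) : ℝ × RealPath T :=
  (ξ ω, pathOf T fun t ↦ B t ω)

lemma aemeasurable_initialNoise (T : ℝ≥0) {ξ : Ω → ℝ} {B : ℝ≥0 → Ω → ℝ} (hξ : AEMeasurable ξ P)
    (hB : IsBrownianReal B P) : AEMeasurable (initialNoise T ξ B) P :=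
  hξ.prodMk (aemeasurable_pathOf T hB.aemeasurable)

lemma isNoiseLaw_map (T : ℝ≥0) {lam : Measure ℝ} {ξ : Ω → ℝ} {B : ℝ≥0 → Ω → ℝ}
    (hξ : HasLaw ξ lam P) (hB : IsBrownianReal B P) :
    IsNoiseLaw T lam (P.map (initialNoise T ξ B)) := by
  have hm := aemeasurable_initialNoise T hξ.aemeasurable hB
  constructor
  · refine ⟨by fun_prop, ?_⟩
    rw [AEMeasurable.map_map_of_aemeasurable (by fun_prop) hm]
    exact hξ.map_eq
  · intro t ht
    have hp : Measurable fun p : ℝ × RealPath T ↦ pathAt p.2 t :=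
      (continuous_pathAt_left t).measurable.comp measurable_snd
    refine ⟨hp.aemeasurable, ?_⟩
    rw [AEMeasurable.map_map_of_aemeasurable hp.aemeasurable hm, ← (hB.hasLaw_eval _).map_eq]
    refine Measure.map_congr ?_
    filter_upwards [hB.cont] with ω hω
    exact pathAt_pathOf hω ht

/-- Pathwise uniqueness identifies the position with the flow. The mean-field identity then comes
from adding `θ` times the expectation of the position equation to the integrated field equation. -/
theorem IsMcKeanVlasovSolution.exists_isMeanField [IsProbabilityMeasure P] {α θ σ μ₀ : ℝ}
    {lam : Measure ℝ} [IsProbabilityMeasure lam] (hlam : Integrable (fun r : ℝ ↦ |r| ^ 3) lam)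
    {B y : ℝ≥0 → Ω → ℝ} {ν : ℝ → ℝ} (h : IsMcKeanVlasovSolution α θ σ μ₀ lam B y ν P) (T : ℝ≥0) :
    ∃ ν' : C(ℝ, ℝ), IsMeanField T α θ σ μ₀ (P.map (initialNoise T (y 0) B)) ν' ∧
      ∀ᵐ ω ∂P, ∀ t ≤ T, y t ω = pathAt (flow T σ ν' (initialNoise T (y 0) B ω)) t := by
  have hνc : ContinuousOn ν (Set.Ici 0) := fun t ht ↦ by
    exact (h.field_eq ⟨t, Set.mem_Ici.1 ht⟩).continuousWithinAt
  -- Nothing is known about `ν` at negative times; it is replaced there by the constant `ν 0` to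
  -- obtain a continuous function on the line.
  let ν' : C(ℝ, ℝ) := ⟨fun s ↦ ν (max s 0), hνc.comp_continuous (by fun_prop)
    fun s ↦ Set.mem_Ici.2 (le_max_right _ _)⟩
  have hν' {s : ℝ} (hs : 0 ≤ s) : ν' s = ν s := by simp [ν', hs]
  have hQ := isNoiseLaw_map T h.law_initial h.isBrownian
  have hm := aemeasurable_initialNoise T h.law_initial.aemeasurable h.isBrownian
  set Q := P.map (initialNoise T (y 0) B) with hQdef
  have := hQ.isProbabilityMeasure
  have hflow : ∀ᵐ ω ∂P, ∀ t ≤ T,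
      y t ω = pathAt (flow T σ ν' (initialNoise T (y 0) B ω)) t := by
    filter_upwards [h.continuous_position, h.isBrownian.cont, h.position_eq] with ω h1 h2 h3 t ht
    refine eq_flow_of_integral_eq T (y := fun t ↦ y t ω) h2 h1 (fun t ↦ ?_) ht
    rw [h3 t]
    congr 2
    refine intervalIntegral.integral_congr fun s hs ↦ ?_
    rw [Set.uIcc_of_le t.coe_nonneg] at hs
    simp only [hν' hs.1]
  refine ⟨ν', fun t ht ↦ ?_, hflow⟩
  obtain ⟨C, hC⟩ := hQ.flow_force σ hlam ν'
  have hCt : ∀ s ∈ Set.Icc (0 : ℝ) t, Integrable (fun p ↦ force (pathAt (flow T σ ν' p) s)) Q ∧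
      ∫ p, |force (pathAt (flow T σ ν' p) s)| ∂Q ≤ C := fun s hs ↦ hC s ⟨hs.1, hs.2.trans ht.2⟩
  have hg : Measurable (Function.uncurry fun (p : ℝ × RealPath T) (s : ℝ) ↦
      force (pathAt (flow T σ ν' p) s)) :=
    (continuous_force.comp (continuous_flow_at T σ ν')).measurable
  have hforce {s : ℝ} (hs : s ∈ Set.Icc (0 : ℝ) T) :
      ∫ ω, (y s.toNNReal ω ^ 3 - y s.toNNReal ω) ∂P =
        -∫ p, force (pathAt (flow T σ ν' p) s) ∂Q := by
    have hms : Measurable fun p ↦ force (pathAt (flow T σ ν' p) s) :=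
      continuous_force.measurable.comp (measurable_flow_at T σ ν' s)
    rw [hQdef, integral_map hm hms.aestronglyMeasurable, ← integral_neg]
    refine integral_congr_ae ?_
    filter_upwards [hflow] with ω hω
    rw [hω _ (Real.toNNReal_le_iff_le_coe.2 hs.2), Real.coe_toNNReal _ hs.1, force]
    ring
  have hI := intervalIntegrable_integral_of_bound hg ht.1 hCt
  have hFTC : ∫ s in (0 : ℝ)..t, (-(α - θ) * ν' s -
      θ * ∫ p, force (pathAt (flow T σ ν' p) s) ∂Q) = ν t - ν 0 := by
    refine intervalIntegral.integral_eq_sub_of_hasDeriv_right_of_le ht.1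
      (hνc.mono fun s hs ↦ hs.1) (fun s hs ↦ ?_) ?_
    · have := h.field_eq s.toNNReal
      rw [hforce ⟨hs.1.le, hs.2.le.trans ht.2⟩, Real.coe_toNNReal _ hs.1.le, mul_neg,
        ← sub_eq_add_neg, ← hν' hs.1.le] at this
      exact this.mono fun r hr ↦ hs.1.le.trans (le_of_lt hr)
    · exact (Continuous.intervalIntegrable (by fun_prop) _ _).sub (hI.const_mul θ)
  have hνi : IntervalIntegrable ν' volume 0 t := ν'.continuous.intervalIntegrable _ _
  rw [intervalIntegral.integral_sub (hνi.const_mul _) (hI.const_mul θ),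
    intervalIntegral.integral_const_mul, intervalIntegral.integral_const_mul,
    ← integral_intervalIntegral_of_bound hg ht.1 hCt, h.field_initial, ← hν' ht.1] at hFTC
  have i1 := integrable_intervalIntegral_of_bound hg ht.1 hCt
  have hξi : Integrable (fun p : ℝ × RealPath T ↦ p.1) Q := by
    obtain ⟨h1, -⟩ := hQ.noiseSize_first σ hlam
    refine h1.mono' (by fun_prop) (ae_of_all _ fun p ↦ ?_)
    have := intervalIntegral.integral_nonneg (μ := volume) T.coe_nonneg fun s _ ↦
      abs_nonneg (force (σ * pathAt p.2 s))
    simpa [noiseSize] using this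
  have hwi : Integrable (fun p : ℝ × RealPath T ↦ pathAt p.2 t) Q := by
    have := hQ.integrable_abs_pow ht 1
    simp only [pow_one] at this
    exact (integrable_norm_iff (hQ.eval t ht).aemeasurable.aestronglyMeasurable).1 this
  have hE : ∫ p, pathAt (flow T σ ν' p) t ∂Q = (∫ p, p.1 ∂Q) +
      (∫ p, (∫ s in (0 : ℝ)..t, force (pathAt (flow T σ ν' p) s)) ∂Q) -
        ∫ s in (0 : ℝ)..t, ν' s := by
    have e (p : ℝ × RealPath T) : pathAt (flow T σ ν' p) t = p.1 +
        (∫ s in (0 : ℝ)..t, force (pathAt (flow T σ ν' p) s)) - (∫ s in (0 : ℝ)..t, ν' s) +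
          σ * pathAt p.2 t := by
      rw [flow_eq p ht, intervalIntegral.integral_sub _ hνi]
      · ring
      · exact Continuous.intervalIntegrable
          (continuous_force.comp (continuous_pathAt_right _)) _ _
    simp_rw [e]
    have k1 : Integrable (fun p : ℝ × RealPath T ↦ p.1 +
        ∫ s in (0 : ℝ)..t, force (pathAt (flow T σ ν' p) s)) Q := hξi.add i1
    have k2 : Integrable (fun p : ℝ × RealPath T ↦ p.1 +
        (∫ s in (0 : ℝ)..t, force (pathAt (flow T σ ν' p) s)) - ∫ s in (0 : ℝ)..t, ν' s) Q :=
      k1.sub (integrable_const _)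
    rw [integral_add k2 (hwi.const_mul σ), integral_sub k1 (integrable_const _), integral_add hξi i1, integral_const_mul,
      hQ.integral_eval ht]
    simp
  -- The expected force carries the factor `θ` here and `-θ` in `hFTC`, so it cancels, and `-(α - θ)
  -- - θ = -α` remains in front of the integral of the field.
  rw [hE]
  linear_combination -hFTC

end

/-! ### The coupling estimate -/

/-- The driving fluctuation: the deviations of the empirical means of `N` independent copies of
the limit process from the means `m` and `m₀`. -/
noncomputable def fluctuation {T : ℝ≥0} (θ σ : ℝ) (ν : C(ℝ, ℝ)) {N : ℕ} (m : ℝ → ℝ) (m₀ : ℝ)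
    (q : Fin N → ℝ × RealPath T) (s : ℝ) : ℝ :=
  θ * |(∑ j, pathAt (flow T σ ν (q j)) s) / N - m s| + θ * |(∑ j, (q j).1) / N - m₀|

lemma continuous_fluctuation {T : ℝ≥0} (θ σ : ℝ) (ν : C(ℝ, ℝ)) {N : ℕ} {m : ℝ → ℝ}
    (hm : Continuous m) (m₀ : ℝ) :
    Continuous fun q : (Fin N → ℝ × RealPath T) × ℝ ↦ fluctuation θ σ ν m m₀ q.1 q.2 := by
  unfold fluctuation
  have h (j : Fin N) : Continuous fun q : (Fin N → ℝ × RealPath T) × ℝ ↦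
      pathAt (flow T σ ν (q.1 j)) q.2 :=
    (continuous_flow_at T σ ν).comp
      (by fun_prop : Continuous fun q : (Fin N → ℝ × RealPath T) × ℝ ↦ (q.1 j, q.2))
  fun_prop

lemma continuous_fluctuation_right {T : ℝ≥0} (θ σ : ℝ) (ν : C(ℝ, ℝ)) {N : ℕ} {m : ℝ → ℝ}
    (hm : Continuous m) (m₀ : ℝ) (q : Fin N → ℝ × RealPath T) :
    Continuous fun s ↦ fluctuation θ σ ν m m₀ q s :=
  Continuous.comp (g := fun r : (Fin N → ℝ × RealPath T) × ℝ ↦ fluctuation θ σ ν m m₀ r.1 r.2)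
    (f := fun s ↦ (q, s)) (continuous_fluctuation θ σ ν hm m₀) (by fun_prop)

lemma measurable_fluctuation_left {T : ℝ≥0} (θ σ : ℝ) (ν : C(ℝ, ℝ)) {N : ℕ} {m : ℝ → ℝ}
    (hm : Continuous m) (m₀ : ℝ) (s : ℝ) :
    Measurable fun q : Fin N → ℝ × RealPath T ↦ fluctuation θ σ ν m m₀ q s :=
  Measurable.comp (g := fun r : (Fin N → ℝ × RealPath T) × ℝ ↦ fluctuation θ σ ν m m₀ r.1 r.2)
    (f := fun q ↦ (q, s)) (continuous_fluctuation θ σ ν hm m₀).measurable (by fun_prop)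

/-- The combination `μ + θ x̄` has no noise and no force. -/
lemma field_add_mean_eq {α θ σ : ℝ} {N : ℕ} (hN : 1 ≤ N) {w x : Fin N → ℝ≥0 → ℝ} {μ : ℝ≥0 → ℝ}
    (hx : ∀ j, Continuous (x j)) (hμ : Continuous μ)
    (hpos : ∀ j (t : ℝ≥0), x j t =
      x j 0 + (∫ s in (0 : ℝ)..t, (force (x j s.toNNReal) - μ s.toNNReal)) + σ * w j t)
    (hfield : ∀ t : ℝ≥0, μ t = μ 0 + (∫ s in (0 : ℝ)..t,
      (-(α - θ) * μ s.toNNReal - θ / N * ∑ j, force (x j s.toNNReal)))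
        - θ * σ / N * ∑ j, w j t) (t : ℝ≥0) :
    μ t + θ * ((∑ j, x j t) / N) =
      μ 0 + θ * ((∑ j, x j 0) / N) - α * ∫ s in (0 : ℝ)..t, μ s.toNNReal := by
  have hN' : (N : ℝ) ≠ 0 := by positivity
  have iμ : Continuous fun s : ℝ ↦ μ s.toNNReal := hμ.comp continuous_real_toNNReal
  have ix (j : Fin N) : Continuous fun s : ℝ ↦ force (x j s.toNNReal) :=
    continuous_force.comp ((hx j).comp continuous_real_toNNReal)
  have h1 : ∑ j, x j t = ∑ j, x j 0 + (∑ j, ∫ s in (0 : ℝ)..t, force (x j s.toNNReal)) -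
      N * (∫ s in (0 : ℝ)..t, μ s.toNNReal) + σ * ∑ j, w j t := by
    have e (j : Fin N) : x j t = x j 0 + (∫ s in (0 : ℝ)..t, force (x j s.toNNReal)) -
        (∫ s in (0 : ℝ)..t, μ s.toNNReal) + σ * w j t := by
      rw [hpos j t, intervalIntegral.integral_sub ((ix j).intervalIntegrable _ _)
        (iμ.intervalIntegrable _ _)]
      ring
    rw [Finset.sum_congr rfl fun j _ ↦ e j, Finset.sum_add_distrib, Finset.sum_sub_distrib,
      Finset.sum_add_distrib, Finset.mul_sum]
    simp
  have h2 := hfield t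
  rw [intervalIntegral.integral_sub, intervalIntegral.integral_const_mul,
    intervalIntegral.integral_const_mul, intervalIntegral.integral_finsetSum
      (fun j _ ↦ (ix j).intervalIntegrable _ _)] at h2
  · rw [h1, h2]
    field_simp
    ring
  · exact (iμ.const_mul _).intervalIntegrable _ _
  · exact Continuous.intervalIntegrable (by fun_prop) _ _

/-- The pathwise coupling estimate. -/
lemma abs_position_sub_flow_le {T : ℝ≥0} {α θ σ μ₀ : ℝ} (hα : 0 ≤ α) (hθ : 0 < θ) {N : ℕ}
    (hN : 1 ≤ N) {w x : Fin N → ℝ≥0 → ℝ} {μ : ℝ≥0 → ℝ} {ν : C(ℝ, ℝ)} {m : ℝ → ℝ} {m₀ : ℝ}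
    (hw : ∀ j, Continuous (w j)) (hx : ∀ j, Continuous (x j)) (hμ : Continuous μ)
    (hμ₀ : μ 0 = μ₀) (hm : Continuous m)
    (hpos : ∀ j (t : ℝ≥0), x j t =
      x j 0 + (∫ s in (0 : ℝ)..t, (force (x j s.toNNReal) - μ s.toNNReal)) + σ * w j t)
    (hfield : ∀ t : ℝ≥0, μ t = μ 0 + (∫ s in (0 : ℝ)..t,
      (-(α - θ) * μ s.toNNReal - θ / N * ∑ j, force (x j s.toNNReal)))
        - θ * σ / N * ∑ j, w j t)
    (hν : ∀ t ∈ Set.Icc (0 : ℝ) T, ν t + θ * m t = μ₀ + θ * m₀ - α * ∫ s in (0 : ℝ)..t, ν s)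
    (i : Fin N) {t : ℝ≥0} (ht : t ≤ T) :
    |x i t - pathAt (flow T σ ν (x i 0, pathOf T (w i))) t| ≤
      Real.exp T * (Real.exp ((θ * Real.exp T + α) * T) *
        ∫ s in (0 : ℝ)..T, fluctuation θ σ ν m m₀ (fun j ↦ (x j 0, pathOf T (w j))) s) := by
  have hNpos : 0 < (N : ℝ) := by positivity
  set q : Fin N → ℝ × RealPath T := fun j ↦ (x j 0, pathOf T (w j)) with hq
  set e : ℝ → ℝ := fun s ↦ μ s.toNNReal - ν s with he
  have iμ : Continuous fun s : ℝ ↦ μ s.toNNReal := hμ.comp continuous_real_toNNReal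
  have hec : Continuous e := iμ.sub ν.continuous
  have hR : Continuous (fluctuation θ σ ν m m₀ q) :=
    continuous_fluctuation_right θ σ ν hm m₀ q
  -- Particle and copy share start and noise, so only the difference of the fields separates them.
  have hd (j : Fin N) {t : ℝ} (ht : t ∈ Set.Icc (0 : ℝ) T) :
      |x j t.toNNReal - pathAt (flow T σ ν (q j)) t| ≤
        Real.exp T * ∫ s in (0 : ℝ)..t, |e s| := by
    have := abs_sub_le_of_field (T := T) iμ ν.continuous
      ((continuous_pathAt_right (q j).2).const_mul σ)
      ((hx j).comp continuous_real_toNNReal) (continuous_pathAt_right (flow T σ ν (q j)))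
      (ξ₁ := x j 0) (fun t ht ↦ ?_) (fun t ht ↦ flow_eq (q j) ht) ht
    · simp only [hq, sub_self, abs_zero, zero_add] at this
      refine this.trans ?_
      have := intervalIntegral.integral_nonneg (μ := volume) ht.1 fun s _ ↦ abs_nonneg (e s)
      gcongr
      exact ht.2
    · have h1 := hpos j t.toNNReal
      rw [Real.coe_toNNReal _ ht.1] at h1
      simp only [Function.comp_apply]
      rw [h1]
      congr 2
      exact (pathAt_pathOf (hw j) ht).symm
  have key := integral_abs_le_of_abs_le_integral (e := e) (R := fluctuation θ σ ν m m₀ q)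
    (L := θ * Real.exp T + α) hec hR
    (fun s ↦ by unfold fluctuation; positivity) (by positivity) T.coe_nonneg (fun t ht ↦ ?_)
  · have h1 := hd i (t := t) ⟨t.coe_nonneg, by exact_mod_cast ht⟩
    rw [Real.toNNReal_coe] at h1
    refine h1.trans ?_
    gcongr
    refine le_trans ?_ key
    exact intervalIntegral.integral_mono_interval le_rfl t.coe_nonneg (by exact_mod_cast ht)
      (Eventually.of_forall fun _ ↦ abs_nonneg _) (hec.abs.intervalIntegrable _ _)
  · set S := ∫ s in (0 : ℝ)..t, |e s| with hS
    have c1 := field_add_mean_eq hN hx hμ hpos hfield t.toNNReal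
    rw [Real.coe_toNNReal _ ht.1, hμ₀] at c1
    have c2 := hν t ht
    have hI : ∫ s in (0 : ℝ)..t, e s =
        (∫ s in (0 : ℝ)..t, μ s.toNNReal) - ∫ s in (0 : ℝ)..t, ν s :=
      intervalIntegral.integral_sub (iμ.intervalIntegrable _ _)
        (ν.continuous.intervalIntegrable _ _)
    set Y := (∑ j, pathAt (flow T σ ν (q j)) t) / N with hY
    set D := (∑ j, (x j t.toNNReal - pathAt (flow T σ ν (q j)) t)) / N with hDdef
    have hD : |D| ≤ Real.exp T * S := by
      rw [hDdef, abs_div, abs_of_pos hNpos, div_le_iff₀ hNpos]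
      refine (Finset.abs_sum_le_sum_abs _ _).trans ?_
      refine (Finset.sum_le_card_nsmul _ _ _ fun j _ ↦ hd j ht).trans ?_
      simp [mul_comm]
      exact le_rfl
    have hXD : (∑ j, x j t.toNNReal) / N = D + Y := by
      rw [hDdef, hY, Finset.sum_sub_distrib]; ring
    have hIS : |∫ s in (0 : ℝ)..t, e s| ≤ S := intervalIntegral.abs_integral_le_integral_abs ht.1
    -- The difference of the identities for `μ + θ x̄` and `ν + θ m`; the mean of the particles is
    -- split into `D`, controlled by the field, and the mean `Y` of the copies, which fluctuates
    -- around `m`.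
    have e1 : e t = (-(θ * D) + -(α * ∫ s in (0 : ℝ)..t, e s)) +
        (-(θ * (Y - m t)) + θ * ((∑ j, x j 0) / N - m₀)) := by
      rw [hXD] at c1
      simp only [he] at hI ⊢
      rw [hI]
      linear_combination c1 - c2
    rw [e1]
    refine (abs_add_le _ _).trans (add_le_add ?_ ?_)
    · refine (abs_add_le _ _).trans ?_
      rw [abs_neg, abs_neg, abs_mul, abs_mul, abs_of_pos hθ, abs_of_nonneg hα, add_mul, mul_assoc]
      gcongr
    · refine (abs_add_le _ _).trans ?_
      rw [abs_neg, abs_mul, abs_mul, abs_of_pos hθ, fluctuation]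

/-- The mean of `N` independent variables with common mean deviates from it by `√(V/N)`. -/
lemma integral_abs_mean_sub_le {Ω : Type*} [MeasurableSpace Ω] {P : Measure Ω}
    [IsProbabilityMeasure P] {N : ℕ} (hN : 1 ≤ N) {X : Fin N → Ω → ℝ} (hind : iIndepFun X P)
    (hX : ∀ i, MemLp (X i) 2 P) {m V : ℝ} (hm : ∀ i, ∫ ω, X i ω ∂P = m)
    (hV : ∀ i, ∫ ω, X i ω ^ 2 ∂P ≤ V) :
    Integrable (fun ω ↦ |(∑ i, X i ω) / N - m|) P ∧
      ∫ ω, |(∑ i, X i ω) / N - m| ∂P ≤ √V / √N := by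
  have hNpos : 0 < (N : ℝ) := by positivity
  have hS : MemLp (∑ i, X i) 2 P := memLp_finsetSum' _ fun i _ ↦ hX i
  have hES : ∫ ω, (∑ i, X i) ω ∂P = N * m := by
    simp_rw [Finset.sum_apply]
    rw [integral_finsetSum _ fun i _ ↦ (hX i).integrable one_le_two]
    simp [hm]
  have hVar : Var[∑ i, X i; P] ≤ N * V := by
    rw [IndepFun.variance_sum (fun i _ ↦ hX i) fun i _ j _ hij ↦ hind.indepFun hij]
    refine (Finset.sum_le_card_nsmul _ _ V fun i _ ↦ ?_).trans (by simp)
    rw [variance_eq_sub (hX i)]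
    refine le_trans ?_ (hV i)
    simp only [Pi.pow_apply]
    nlinarith [sq_nonneg (∫ ω, X i ω ∂P)]
  rw [variance_eq_integral hS.aemeasurable, hES] at hVar
  set f : Ω → ℝ := fun ω ↦ |(∑ i, X i ω) / N - m| with hf
  have hfL : MemLp f 2 P := by
    have : MemLp (fun ω ↦ ‖(N : ℝ)⁻¹ * (∑ i, X i) ω - m‖) 2 P :=
      ((hS.const_mul _).sub (memLp_const m)).norm
    convert this using 2 with ω
    simp only [hf]
    rw [Real.norm_eq_abs, Finset.sum_apply, div_eq_inv_mul]
  have hsq : ∫ ω, f ω ^ 2 ∂P ≤ V / N := by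
    have e (ω : Ω) : f ω ^ 2 = ((N : ℝ)⁻¹) ^ 2 * ((∑ i, X i) ω - N * m) ^ 2 := by
      rw [hf, sq_abs, Finset.sum_apply, ← mul_pow]
      congr 1
      field_simp
    simp_rw [e]
    rw [integral_const_mul]
    calc ((N : ℝ)⁻¹) ^ 2 * ∫ ω, ((∑ i, X i) ω - N * m) ^ 2 ∂P
        ≤ ((N : ℝ)⁻¹) ^ 2 * (N * V) := by gcongr
      _ = V / N := by field_simp
  refine ⟨hfL.integrable one_le_two, ?_⟩
  rw [← Real.sqrt_div' _ hNpos.le]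
  refine Real.le_sqrt_of_sq_le (le_trans ?_ hsq)
  -- Nonnegativity of the variance is `(E f)² ≤ E f²`.
  have := variance_nonneg f P
  rw [variance_eq_sub hfL] at this
  simp only [Pi.pow_apply] at this
  linarith

/-- The constant of the coupling estimate. -/
noncomputable def couplingConst (T : ℝ≥0) (α θ σ μ₀ : ℝ) (lam : Measure ℝ) : ℝ :=
  Real.exp T * (Real.exp ((θ * Real.exp T + α) * T) *
    (T * (θ * √(limitMoment T α θ σ μ₀ lam) + θ * √(1 + ∫ r, |r| ^ 3 ∂lam))))

lemma couplingConst_nonneg {T : ℝ≥0} {α θ σ μ₀ : ℝ} (hθ : 0 < θ) {lam : Measure ℝ} :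
    0 ≤ couplingConst T α θ σ μ₀ lam := by
  unfold couplingConst; positivity

/-- The data of the particles are independent. -/
lemma IsChaoticParticleSystem.iIndepFun_initialNoise {Ω : Type*} [MeasurableSpace Ω]
    {P : Measure Ω} [IsProbabilityMeasure P] {α θ σ μ₀ : ℝ} {lam : Measure ℝ} {N : ℕ}
    {w x : Fin N → ℝ≥0 → Ω → ℝ} {μ : ℝ≥0 → Ω → ℝ}
    (h : IsChaoticParticleSystem α θ σ μ₀ lam w x μ P) (T : ℝ≥0) :
    iIndepFun (fun j ↦ initialNoise T (x j 0) (w j)) P := by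
  have hsol := h.solution
  refine iIndepFun_prodMk (fun j ↦ (h.law_initial j).aemeasurable)
    (fun j ↦ aemeasurable_pathOf T (hsol.isBrownian j).aemeasurable) h.indep_initial
    (hsol.indep_brownian.comp (fun _ ↦ pathOf T) fun _ ↦ measurable_pathOf T) ?_
  exact h.indep_initial_brownian.comp measurable_id
    (measurable_pi_lambda (fun (v : Fin N → ℝ≥0 → ℝ) j ↦ pathOf T (v j))
      fun j ↦ (measurable_pathOf T).comp (measurable_pi_apply j))

/-- The copies are built on the space of the particles by applying `flow` to their data. Since `ν`
is tied only to the law `Q` of these data, it may come from a limit solution on another probability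
space. -/
theorem IsChaoticParticleSystem.lintegral_iSup_le {Ω : Type*} [MeasurableSpace Ω] {P : Measure Ω}
    [IsProbabilityMeasure P] {T : ℝ≥0} {α θ σ μ₀ : ℝ} (hα : 0 ≤ α) (hθ : 0 < θ) {lam : Measure ℝ}
    [IsProbabilityMeasure lam] (hlam : Integrable (fun r : ℝ ↦ |r| ^ 3) lam) {N : ℕ} (hN : 1 ≤ N)
    {w x : Fin N → ℝ≥0 → Ω → ℝ} {μ : ℝ≥0 → Ω → ℝ}
    (h : IsChaoticParticleSystem α θ σ μ₀ lam w x μ P) {Q : Measure (ℝ × RealPath T)}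
    {ν : C(ℝ, ℝ)} (hQ : ∀ j, P.map (initialNoise T (x j 0) (w j)) = Q)
    (hν : IsMeanField T α θ σ μ₀ Q ν) (i : Fin N) :
    ∫⁻ ω, (⨆ t ∈ Set.Icc 0 T,
      ‖x i t ω - pathAt (flow T σ ν (initialNoise T (x i 0) (w i) ω)) t‖ₑ) ∂P ≤
        ENNReal.ofReal (couplingConst T α θ σ μ₀ lam / √N) := by
  have hsol := h.solution
  have hNoise : IsNoiseLaw T lam Q :=
    hQ i ▸ isNoiseLaw_map T (h.law_initial i) (hsol.isBrownian i)
  have := hNoise.isProbabilityMeasure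
  set p : Fin N → Ω → ℝ × RealPath T := fun j ↦ initialNoise T (x j 0) (w j) with hp
  have mp (j : Fin N) : AEMeasurable (p j) P :=
    aemeasurable_initialNoise T (h.law_initial j).aemeasurable (hsol.isBrownian j)
  have hind : iIndepFun p P := h.iIndepFun_initialNoise T
  have mP : AEMeasurable (fun ω j ↦ p j ω) P := aemeasurable_pi_lambda _ mp
  set Pi := P.map (fun ω j ↦ p j ω) with hPi
  have : IsProbabilityMeasure Pi := Measure.isProbabilityMeasure_map mP
  have hcomp {g : ℝ × RealPath T → ℝ} (hg : Measurable g) (hg2 : MemLp g 2 Q) {V : ℝ}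
      (hV : ∫ r, g r ^ 2 ∂Q ≤ V) :
      Integrable (fun ω ↦ |(∑ j, g (p j ω)) / N - ∫ r, g r ∂Q|) P ∧
        ∫ ω, |(∑ j, g (p j ω)) / N - ∫ r, g r ∂Q| ∂P ≤ √V / √N := by
    refine integral_abs_mean_sub_le hN (X := fun j ω ↦ g (p j ω))
      (hind.comp (fun _ ↦ g) fun _ ↦ hg) (fun j ↦ ?_) (fun j ↦ ?_) (fun j ↦ ?_)
    · rw [← hQ j] at hg2
      exact hg2.comp_of_map (mp j)
    · rw [← hQ j, integral_map (mp j) hg.aestronglyMeasurable]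
    · rw [← hQ j, integral_map (mp j) (hg.pow_const 2).aestronglyMeasurable] at hV
      exact hV
  set m₀ := ∫ r, r.1 ∂Q with hm₀
  -- The mean of the copies is read off from the mean-field identity. Its continuity in time is then
  -- immediate, without a limit under the expectation.
  set m : ℝ → ℝ := fun t ↦ (μ₀ + θ * m₀ - α * (∫ s in (0 : ℝ)..t, ν s) - ν t) / θ with hm
  have hmc : Continuous m := by
    have := intervalIntegral.continuous_primitive
      (fun a b ↦ ν.continuous.intervalIntegrable (μ := volume) a b) 0
    fun_prop
  have hmθ (t : ℝ) : ν t + θ * m t = μ₀ + θ * m₀ - α * ∫ s in (0 : ℝ)..t, ν s := by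
    rw [hm]; field_simp; ring
  have hmE {t : ℝ} (ht : t ∈ Set.Icc (0 : ℝ) T) : m t = ∫ r, pathAt (flow T σ ν r) t ∂Q := by
    have h1 := hmθ t
    have h2 := hν t ht
    exact mul_left_cancel₀ hθ.ne' (by linarith)
  have hfst : MemLp (fun r : ℝ × RealPath T ↦ r.1) 2 Q ∧
      ∫ r : ℝ × RealPath T, r.1 ^ 2 ∂Q ≤ 1 + ∫ r, |r| ^ 3 ∂lam := by
    have hle (r : ℝ) : r ^ 2 ≤ 1 + |r| ^ 3 := by
      rw [← sq_abs]
      have := abs_nonneg r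
      nlinarith [sq_nonneg (|r| - 1), mul_nonneg this (sq_nonneg (|r| - 1))]
    have hi := (integrable_const (μ := lam) (1 : ℝ)).add hlam
    have hI : Integrable (fun r ↦ r ^ 2) lam := hi.mono' (by fun_prop) (ae_of_all _ fun r ↦ by
      rw [Real.norm_of_nonneg (sq_nonneg _)]; exact hle _)
    constructor
    · have h2 := (memLp_two_iff_integrable_sq (f := fun r : ℝ ↦ r) (by fun_prop)).2 hI
      rw [← hNoise.fst.map_eq] at h2
      exact h2.comp_of_map hNoise.fst.aemeasurable
    · have h2 := hNoise.fst.integral_comp (f := fun r : ℝ ↦ r ^ 2) (by fun_prop)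
      refine (h2.le).trans ((integral_mono hI hi hle).trans ?_)
      rw [integral_add' (integrable_const _) hlam]
      simp
  set g : (Fin N → ℝ × RealPath T) → ℝ → ℝ := fluctuation θ σ ν m m₀ with hg
  have hg0 (q : Fin N → ℝ × RealPath T) (s : ℝ) : 0 ≤ g q s := by
    rw [hg, fluctuation]; positivity
  have hgm : Measurable (Function.uncurry g) := (continuous_fluctuation θ σ ν hmc m₀).measurable
  set C := (θ * √(limitMoment T α θ σ μ₀ lam) + θ * √(1 + ∫ r, |r| ^ 3 ∂lam)) / √N with hC
  have hgb : ∀ s ∈ Set.Icc (0 : ℝ) T, Integrable (fun q ↦ g q s) Pi ∧ ∫ q, |g q s| ∂Pi ≤ C := by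
    intro s hs
    have hK := hν.integral_abs_le hα hθ hNoise hlam
    obtain ⟨f1, f2⟩ := hNoise.flow_memLp_two σ hlam ν hK hs
    obtain ⟨a1, a2⟩ := hcomp (measurable_flow_at T σ ν s) f1 f2
    obtain ⟨b1, b2⟩ := hcomp measurable_fst hfst.1 hfst.2
    rw [← hmE hs] at a1 a2
    rw [← hm₀] at b1 b2
    have hms : Measurable fun q ↦ g q s := measurable_fluctuation_left θ σ ν hmc m₀ s
    have hi : Integrable (fun ω ↦ g (fun j ↦ p j ω) s) P :=
      (a1.const_mul θ).add (b1.const_mul θ)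
    constructor
    · exact (integrable_map_measure hms.aestronglyMeasurable mP).2 hi
    · simp_rw [abs_of_nonneg (hg0 _ _)]
      rw [hPi, integral_map mP hms.aestronglyMeasurable]
      simp only [hg, fluctuation]
      rw [integral_add (a1.const_mul θ) (b1.const_mul θ), integral_const_mul, integral_const_mul,
        hC, add_div, mul_div_assoc, mul_div_assoc]
      gcongr
      exact a2
  have hI := integrable_intervalIntegral_of_bound hgm T.coe_nonneg hgb
  have hE := integral_intervalIntegral_of_bound hgm T.coe_nonneg hgb
  have hle : ∫ q, (∫ s in (0 : ℝ)..T, g q s) ∂Pi ≤ T * C := by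
    rw [hE]
    refine (intervalIntegral.integral_mono_on T.coe_nonneg
      (intervalIntegrable_integral_of_bound hgm T.coe_nonneg hgb)
      (intervalIntegrable_const (c := C)) fun s hs ↦ ?_).trans (by simp)
    exact (integral_mono (hgb s hs).1 (hgb s hs).1.abs fun q ↦ le_abs_self _).trans (hgb s hs).2
  set E := Real.exp T * Real.exp ((θ * Real.exp T + α) * T) with hEdef
  have hpath : ∀ᵐ ω ∂P, (⨆ t ∈ Set.Icc 0 T,
      ‖x i t ω - pathAt (flow T σ ν (initialNoise T (x i 0) (w i) ω)) t‖ₑ) ≤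
        ENNReal.ofReal (E * ∫ s in (0 : ℝ)..T, g (fun j ↦ p j ω) s) := by
    filter_upwards [hsol.continuous_position, hsol.continuous_field, hsol.position_eq,
      hsol.field_eq, h.field_initial, ae_all_iff.2 fun j ↦ (hsol.isBrownian j).cont]
      with ω h1 h2 h3 h4 h5 h6
    refine iSup₂_le fun t ht ↦ ?_
    rw [← ofReal_norm]
    refine ENNReal.ofReal_le_ofReal ?_
    have := abs_position_sub_flow_le hα hθ hN (w := fun j t ↦ w j t ω) (x := fun j t ↦ x j t ω)
      (μ := fun t ↦ μ t ω) h6 h1 h2 h5 hmc h3 h4 (fun t _ ↦ hmθ t) i ht.2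
    rw [hEdef, mul_assoc]
    exact this
  have hIP : Integrable (fun ω ↦ ∫ s in (0 : ℝ)..T, g (fun j ↦ p j ω) s) P := by
    rw [hPi] at hI
    exact hI.comp_aemeasurable mP
  have hEP : ∫ q, (∫ s in (0 : ℝ)..T, g q s) ∂Pi =
      ∫ ω, (∫ s in (0 : ℝ)..T, g (fun j ↦ p j ω) s) ∂P :=
    integral_map mP hI.aestronglyMeasurable
  refine (lintegral_mono_ae hpath).trans ?_
  rw [← ofReal_integral_eq_lintegral_ofReal (hIP.const_mul E) (ae_of_all _ fun ω ↦ ?_)]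
  · refine ENNReal.ofReal_le_ofReal ?_
    rw [integral_const_mul, ← hEP]
    calc E * ∫ q, (∫ s in (0 : ℝ)..T, g q s) ∂Pi ≤ E * (T * C) := by gcongr
      _ = _ := by rw [hEdef, hC, couplingConst]; ring
  · exact mul_nonneg (by positivity)
      (intervalIntegral.integral_nonneg T.coe_nonneg fun s _ ↦ hg0 _ _)

/-! ### Convergence in law -/

/-- Processes which approach, in mean, processes with the law of `Z` converge in law to `Z`. -/
lemma tendstoInDistribution_of_coupling {E : Type*} [MetricSpace E] [MeasurableSpace E]
    [BorelSpace E] {Ω : ℕ → Type*} [∀ n, MeasurableSpace (Ω n)] {P : ∀ n, Measure (Ω n)}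
    [∀ n, IsProbabilityMeasure (P n)] {Ω' : Type*} [MeasurableSpace Ω'] {P' : Measure Ω'}
    [IsProbabilityMeasure P'] {X Y : ∀ n, Ω n → E} {Z : Ω' → E}
    (hX : ∀ n, AEMeasurable (X n) (P n)) (hY : ∀ n, AEMeasurable (Y n) (P n))
    (hZ : AEMeasurable Z P') (hlaw : ∀ n, (P n).map (Y n) = P'.map Z)
    (hlim : Tendsto (fun n ↦ ∫⁻ ω, edist (X n ω) (Y n ω) ∂(P n)) atTop (𝓝 0)) :
    TendstoInDistribution X atTop Z P P' := by
  refine ⟨hX, hZ, ?_⟩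
  refine tendsto_iff_forall_lipschitz_integral_tendsto.2 ?_
  rintro f ⟨C, hC⟩ ⟨L, hL⟩
  change Tendsto (fun n ↦ ∫ z, f z ∂((P n).map (X n))) atTop (𝓝 (∫ z, f z ∂(P'.map Z)))
  have hfm : Measurable f := hL.continuous.measurable
  -- `hC` bounds only the oscillation of `f`; a base point turns it into a bound on `f`.
  obtain ⟨ω₀⟩ := P'.nonempty_of_neZero
  have hb {n : ℕ} {V : Ω n → E} (hV : AEMeasurable V (P n)) :
      Integrable (fun ω ↦ f (V ω)) (P n) := by
    refine Integrable.of_bound (hfm.comp_aemeasurable hV).aestronglyMeasurable (C + ‖f (Z ω₀)‖)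
      (ae_of_all _ fun ω ↦ ?_)
    have h1 := hC (V ω) (Z ω₀)
    rw [dist_eq_norm] at h1
    linarith [norm_sub_norm_le (f (V ω)) (f (Z ω₀))]
  rw [tendsto_iff_edist_tendsto_0]
  have hlim' : Tendsto (fun n ↦ (L : ℝ≥0∞) * ∫⁻ ω, edist (X n ω) (Y n ω) ∂(P n)) atTop (𝓝 0) := by
    simpa using ENNReal.Tendsto.const_mul hlim (Or.inr ENNReal.coe_ne_top)
  refine tendsto_of_tendsto_of_tendsto_of_le_of_le tendsto_const_nhds hlim' (fun _ ↦ zero_le)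
    fun n ↦ ?_
  rw [← hlaw n, integral_map (hX n) hfm.aestronglyMeasurable,
    integral_map (hY n) hfm.aestronglyMeasurable, edist_eq_enorm_sub,
    ← integral_sub (hb (hX n)) (hb (hY n))]
  refine (enorm_integral_le_lintegral_enorm _).trans ?_
  rw [← lintegral_const_mul' _ _ ENNReal.coe_ne_top]
  refine lintegral_mono fun ω ↦ ?_
  rw [← edist_eq_enorm_sub]
  exact hL _ _

/-- The vector-valued path with given coordinates. -/
def assemble (T : ℝ≥0) (k : ℕ) (f : Fin k → RealPath T) : C(Set.Icc (0 : ℝ≥0) T, Fin k → ℝ) :=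
  ⟨fun t i ↦ f i t, continuous_pi fun i ↦ (f i).continuous⟩

lemma edist_assemble_le {T : ℝ≥0} {k : ℕ} (f g : Fin k → RealPath T) :
    edist (assemble T k f) (assemble T k g) ≤ edist f g := by
  rw [ContinuousMap.edist_eq_iSup]
  refine iSup_le fun t ↦ edist_pi_le_iff.2 fun i ↦ ?_
  refine le_trans ?_ (edist_le_pi_edist f g i)
  rw [ContinuousMap.edist_eq_iSup]
  exact le_iSup (fun t ↦ edist (f i t) (g i t)) t

lemma measurable_assemble (T : ℝ≥0) (k : ℕ) : Measurable (assemble T k) := by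
  have : LipschitzWith 1 (assemble T k) := fun f g ↦ by
    simpa using edist_assemble_le f g
  exact this.continuous.measurable

lemma pathOn_eq_assemble {Ω : Type*} [MeasurableSpace Ω] (T : ℝ≥0) {k : ℕ}
    {X : Fin k → ℝ≥0 → Ω → ℝ} {ω : Ω} (h : ∀ i, Continuous fun t ↦ X i t ω) :
    pathOn T X ω = assemble T k fun i ↦ pathOf T fun t ↦ X i t ω := by
  rw [pathOn, dif_pos h]
  ext t i
  exact (pathOf_apply (h i) t).symm

lemma edist_pathOf_le {T : ℝ≥0} {h : ℝ≥0 → ℝ} (hh : Continuous h) (f : RealPath T) :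
    edist (pathOf T h) f ≤ ⨆ t ∈ Set.Icc 0 T, ‖h t - pathAt f t‖ₑ := by
  rw [ContinuousMap.edist_eq_iSup]
  refine iSup_le fun t ↦ ?_
  rw [pathOf_apply hh, edist_eq_enorm_sub, ← pathAt_coe]
  exact le_iSup₂ (f := fun (t : ℝ≥0) (_ : t ∈ Set.Icc 0 T) ↦ ‖h t - pathAt f t‖ₑ) t.1 t.2

/-- Each `y i` brings its own field `ν i`, and the `i`-th particle is coupled to the flow for that
field. Thus uniqueness of the limit field is not needed. -/
theorem tendstoInDistribution_pathOn {α θ σ μ₀ : ℝ} (hα : 0 ≤ α) (hθ : 0 < θ)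
    {lam : Measure ℝ} [IsProbabilityMeasure lam] (hlam : Integrable (fun r : ℝ ↦ |r| ^ 3) lam)
    {Ω : ℕ → Type*} [∀ N, MeasurableSpace (Ω N)] {P : ∀ N, Measure (Ω N)}
    [∀ N, IsProbabilityMeasure (P N)] {w x : ∀ N, Fin N → ℝ≥0 → Ω N → ℝ}
    {μ : ∀ N, ℝ≥0 → Ω N → ℝ}
    (hsys : ∀ N, 1 ≤ N → IsChaoticParticleSystem α θ σ μ₀ lam (w N) (x N) (μ N) (P N))
    {k : ℕ} (hk : 1 ≤ k) (T : ℝ≥0) {Ω' : Type*} [MeasurableSpace Ω'] {P' : Measure Ω'}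
    [IsProbabilityMeasure P'] {y : Fin k → ℝ≥0 → Ω' → ℝ}
    (hind : iIndepFun (fun j ω t ↦ y j t ω) P')
    (hy : ∀ j, ∃ (B : ℝ≥0 → Ω' → ℝ) (ν : ℝ → ℝ),
      IsMcKeanVlasovSolution α θ σ μ₀ lam B (y j) ν P') :
    TendstoInDistribution (fun n ↦ pathOn T fun i : Fin k ↦ x (k + n) (Fin.castAdd n i))
      atTop (pathOn T y) (fun n ↦ P (k + n)) P' := by
  choose B ν₀ hMV using hy
  choose ν hν hflow using fun j ↦ (hMV j).exists_isMeanField hlam T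
  have hs (n : ℕ) := hsys (k + n) (by omega)
  have hB (n : ℕ) (i : Fin (k + n)) := (hs n).solution.isBrownian i
  set p : ∀ n, Fin k → Ω (k + n) → ℝ × RealPath T := fun n i ↦
    initialNoise T (x (k + n) (Fin.castAdd n i) 0) (w (k + n) (Fin.castAdd n i)) with hp
  have mp (n : ℕ) (i : Fin k) : AEMeasurable (p n i) (P (k + n)) :=
    aemeasurable_initialNoise T ((hs n).law_initial _).aemeasurable (hB n _)
  have mp' (i : Fin k) : AEMeasurable (initialNoise T (y i 0) (B i)) P' :=
    aemeasurable_initialNoise T (hMV i).law_initial.aemeasurable (hMV i).isBrownian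
  have hlawj (n : ℕ) (i : Fin k) (j : Fin (k + n)) :
      (P (k + n)).map (initialNoise T (x (k + n) j 0) (w (k + n) j)) =
        P'.map (initialNoise T (y i 0) (B i)) :=
    map_initial_pathOf_eq T ((hs n).law_initial j) (hMV i).law_initial (hB n j) (hMV i).isBrownian
      ((hs n).indep_initial_brownian.comp (measurable_pi_apply j) (measurable_pi_apply j))
      (hMV i).indep_initial_brownian
  have mF (i : Fin k) : Measurable (flow T σ (ν i)) := (continuous_flow T σ (ν i)).measurable
  have mFp (n : ℕ) (i : Fin k) : AEMeasurable (fun ω ↦ flow T σ (ν i) (p n i ω)) (P (k + n)) :=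
    (mF i).comp_aemeasurable (mp n i)
  have mx (n : ℕ) (i : Fin k) :
      AEMeasurable (fun ω ↦ pathOf T fun t ↦ x (k + n) (Fin.castAdd n i) t ω) (P (k + n)) :=
    aemeasurable_pathOf T fun t ↦ (hs n).solution.aemeasurable_position _ t
  have my (i : Fin k) : AEMeasurable (fun ω ↦ pathOf T fun t ↦ y i t ω) P' :=
    aemeasurable_pathOf T fun t ↦ (hMV i).aemeasurable_position t
  have ex (n : ℕ) : pathOn T (fun i : Fin k ↦ x (k + n) (Fin.castAdd n i)) =ᵐ[P (k + n)]
      fun ω ↦ assemble T k fun i ↦ pathOf T fun t ↦ x (k + n) (Fin.castAdd n i) t ω := by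
    filter_upwards [(hs n).solution.continuous_position] with ω hω
    exact pathOn_eq_assemble T fun i ↦ hω _
  have ey : pathOn T y =ᵐ[P'] fun ω ↦ assemble T k fun i ↦ pathOf T fun t ↦ y i t ω := by
    filter_upwards [ae_all_iff.2 fun i ↦ (hMV i).continuous_position] with ω hω
    exact pathOn_eq_assemble T hω
  have mA := measurable_assemble T k
  refine tendstoInDistribution_of_coupling
    (Y := fun n ω ↦ assemble T k fun i ↦ flow T σ (ν i) (p n i ω)) (fun n ↦ ?_) (fun n ↦ ?_) ?_
    (fun n ↦ ?_) ?_
  · exact (mA.comp_aemeasurable (aemeasurable_pi_lambda _ (mx n))).congr (ex n).symm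
  · exact mA.comp_aemeasurable (aemeasurable_pi_lambda _ (mFp n))
  · exact (mA.comp_aemeasurable (aemeasurable_pi_lambda _ my)).congr ey.symm
  · rw [Measure.map_congr ey]
    have e1 := AEMeasurable.map_map_of_aemeasurable (μ := P (k + n)) mA.aemeasurable
      (aemeasurable_pi_lambda (fun ω i ↦ flow T σ (ν i) (p n i ω)) (mFp n))
    have e2 := AEMeasurable.map_map_of_aemeasurable (μ := P') mA.aemeasurable
      (aemeasurable_pi_lambda (fun ω i ↦ pathOf T fun t ↦ y i t ω) my)
    refine e1.symm.trans (Eq.trans ?_ e2)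
    congr 1
    have hi : iIndepFun (fun i ω ↦ flow T σ (ν i) (p n i ω)) (P (k + n)) :=
      (((hs n).iIndepFun_initialNoise T).precomp (Fin.castAdd_injective k n)).comp
        (fun i ↦ flow T σ (ν i)) mF
    have hi' : iIndepFun (fun i ω ↦ pathOf T fun t ↦ y i t ω) P' :=
      hind.comp (fun _ ↦ pathOf T) fun _ ↦ measurable_pathOf T
    -- Both joint laws are product measures, so it suffices to compare marginals; these are images
    -- under the same flow of the same law of data.
    rw [(iIndepFun_iff_map_fun_eq_pi_map (mFp n)).1 hi, (iIndepFun_iff_map_fun_eq_pi_map my).1 hi']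
    congr 1
    ext1 i
    have h1 : (fun ω ↦ pathOf T fun t ↦ y i t ω) =ᵐ[P']
        fun ω ↦ flow T σ (ν i) (initialNoise T (y i 0) (B i) ω) := by
      filter_upwards [hflow i, (hMV i).continuous_position] with ω h1 h2
      ext t
      rw [pathOf_apply h2, h1 t t.2.2, pathAt_coe]
    rw [Measure.map_congr h1]
    have e3 := AEMeasurable.map_map_of_aemeasurable (mF i).aemeasurable (mp n i)
    have e4 := AEMeasurable.map_map_of_aemeasurable (mF i).aemeasurable (mp' i)
    exact e3.symm.trans ((congrArg _ (hlawj n i _)).trans e4)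
  · set K := couplingConst T α θ σ μ₀ lam
    have hbound (n : ℕ) : ∫⁻ ω, edist (pathOn T (fun i : Fin k ↦ x (k + n) (Fin.castAdd n i)) ω)
        (assemble T k fun i ↦ flow T σ (ν i) (p n i ω)) ∂(P (k + n)) ≤
          k * ENNReal.ofReal (K / √(k + n : ℕ)) := by
      have h1 : ∀ᵐ ω ∂(P (k + n)),
          edist (pathOn T (fun i : Fin k ↦ x (k + n) (Fin.castAdd n i)) ω)
            (assemble T k fun i ↦ flow T σ (ν i) (p n i ω)) ≤
          ∑ i, edist (pathOf T fun t ↦ x (k + n) (Fin.castAdd n i) t ω)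
            (flow T σ (ν i) (p n i ω)) := by
        filter_upwards [ex n] with ω hω
        rw [hω]
        refine (edist_assemble_le _ _).trans (edist_pi_le_iff.2 fun i ↦ ?_)
        exact Finset.single_le_sum (f := fun i ↦
          edist (pathOf T fun t ↦ x (k + n) (Fin.castAdd n i) t ω) (flow T σ (ν i) (p n i ω)))
          (fun _ _ ↦ zero_le) (Finset.mem_univ i)
      refine (lintegral_mono_ae h1).trans ?_
      rw [lintegral_finsetSum' _ fun i _ ↦ (mx n i).edist (mFp n i)]
      refine (Finset.sum_le_card_nsmul _ _ (ENNReal.ofReal (K / √(k + n : ℕ))) fun i _ ↦ ?_).trans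
        (by simp)
      refine le_trans (lintegral_mono_ae ?_) ((hs n).lintegral_iSup_le hα hθ hlam (by omega)
        (hlawj n i) (hν i) (Fin.castAdd n i))
      filter_upwards [(hs n).solution.continuous_position] with ω hω
      exact edist_pathOf_le (hω _) _
    have hlim : Tendsto (fun n : ℕ ↦ (k : ℝ≥0∞) * ENNReal.ofReal (K / √(k + n : ℕ))) atTop
        (𝓝 0) := by
      have h1 : Tendsto (fun n : ℕ ↦ K / √(k + n : ℕ)) atTop (𝓝 0) :=
        tendsto_const_nhds.div_atTop (Real.tendsto_sqrt_atTop.comp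
          (tendsto_natCast_atTop_atTop.comp (tendsto_add_atTop_nat k |>.congr fun n ↦ by omega)))
      have h2 := ENNReal.tendsto_ofReal h1
      rw [ENNReal.ofReal_zero] at h2
      simpa using ENNReal.Tendsto.const_mul h2 (Or.inr (ENNReal.natCast_ne_top k))
    exact tendsto_of_tendsto_of_tendsto_of_le_of_le tendsto_const_nhds hlim (fun _ ↦ zero_le) hbound

/-- The coupling estimate for a given limit process. -/
theorem IsChaoticParticleSystem.lintegral_iSup_sub_le {α θ σ μ₀ : ℝ} (hα : 0 ≤ α) (hθ : 0 < θ)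
    {lam : Measure ℝ} [IsProbabilityMeasure lam] (hlam : Integrable (fun r : ℝ ↦ |r| ^ 3) lam)
    (T : ℝ≥0) {N : ℕ} (hN : 1 ≤ N) {Ω : Type*} [MeasurableSpace Ω] {P : Measure Ω}
    [IsProbabilityMeasure P] {w x : Fin N → ℝ≥0 → Ω → ℝ} {μ : ℝ≥0 → Ω → ℝ}
    (h : IsChaoticParticleSystem α θ σ μ₀ lam w x μ P) (i : Fin N) {y : ℝ≥0 → Ω → ℝ} {ν : ℝ → ℝ}
    (hy : IsMcKeanVlasovSolution α θ σ μ₀ lam (w i) y ν P) (h0 : ∀ᵐ ω ∂P, y 0 ω = x i 0 ω) :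
    ∫⁻ ω, (⨆ t ∈ Set.Icc 0 T, ‖x i t ω - y t ω‖ₑ) ∂P ≤
      ENNReal.ofReal (couplingConst T α θ σ μ₀ lam / √N) := by
  obtain ⟨ν', hν', hflow⟩ := hy.exists_isMeanField hlam T
  -- The field was obtained from the data of `y`, but all particles have data with this same law, so
  -- it is a mean field for each of them.
  have hlaw (j : Fin N) : P.map (initialNoise T (x j 0) (w j)) =
      P.map (initialNoise T (y 0) (w i)) :=
    map_initial_pathOf_eq T (h.law_initial j) hy.law_initial (h.solution.isBrownian j) hy.isBrownian
      (h.indep_initial_brownian.comp (measurable_pi_apply j) (measurable_pi_apply j))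
      hy.indep_initial_brownian
  refine le_trans (lintegral_mono_ae ?_) (h.lintegral_iSup_le hα hθ hlam hN hlaw hν' i)
  filter_upwards [hflow, h0] with ω h1 h2
  refine iSup₂_mono fun t ht ↦ ?_
  rw [h1 t ht.2, initialNoise, initialNoise, h2]

end CooperativeModel

theorem mainTheorem4 (α θ σ μ₀ : ℝ) (hα : 0 ≤ α) (hθ : 0 < θ)
    (lam : Measure ℝ) [IsProbabilityMeasure lam]
    (hlam : Integrable (fun r : ℝ ↦ |r| ^ 3) lam) :
    -- convergence in law on `C([0, T], ℝᵏ)` of the first `k` of `N = k + n` particles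
    (∀ (Ω : ℕ → Type*) [∀ N, MeasurableSpace (Ω N)]
        (P : ∀ N, Measure (Ω N)) [∀ N, IsProbabilityMeasure (P N)]
        (w x : ∀ N, Fin N → ℝ≥0 → Ω N → ℝ) (μ : ∀ N, ℝ≥0 → Ω N → ℝ),
      (∀ N, 1 ≤ N →
        CooperativeModel.IsChaoticParticleSystem α θ σ μ₀ lam (w N) (x N) (μ N) (P N)) →
      ∀ (k : ℕ), 1 ≤ k → ∀ (T : ℝ≥0)
        (Ω' : Type*) [MeasurableSpace Ω'] (P' : Measure Ω') [IsProbabilityMeasure P']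
        (y : Fin k → ℝ≥0 → Ω' → ℝ),
      iIndepFun (fun j ω t ↦ y j t ω) P' →
      (∀ j, ∃ (B : ℝ≥0 → Ω' → ℝ) (ν : ℝ → ℝ),
        CooperativeModel.IsMcKeanVlasovSolution α θ σ μ₀ lam B (y j) ν P') →
      TendstoInDistribution
        (fun n ↦ CooperativeModel.pathOn T fun i : Fin k ↦ x (k + n) (Fin.castAdd n i))
        atTop (CooperativeModel.pathOn T y) (fun n ↦ P (k + n)) P') ∧
    -- coupling bound of order `1 / √N`
    (∀ T : ℝ≥0, ∃ K : ℝ, 0 < K ∧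
      ∀ (N : ℕ), 1 ≤ N → ∀ (Ω : Type*) [MeasurableSpace Ω]
        (P : Measure Ω) [IsProbabilityMeasure P]
        (w x : Fin N → ℝ≥0 → Ω → ℝ) (μ : ℝ≥0 → Ω → ℝ),
      CooperativeModel.IsChaoticParticleSystem α θ σ μ₀ lam w x μ P →
      ∀ (i : Fin N) (y : ℝ≥0 → Ω → ℝ) (ν : ℝ → ℝ),
      CooperativeModel.IsMcKeanVlasovSolution α θ σ μ₀ lam (w i) y ν P →
      (∀ᵐ ω ∂P, y 0 ω = x i 0 ω) →
      ∫⁻ ω, (⨆ t ∈ Set.Icc 0 T, ‖x i t ω - y t ω‖ₑ) ∂P ≤ ENNReal.ofReal (K / √N)) := by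
  refine ⟨fun Ω _ P _ w x μ hsys k hk T Ω' _ P' _ y hind hy ↦
    CooperativeModel.tendstoInDistribution_pathOn hα hθ hlam hsys hk T hind hy, fun T ↦
    -- The added `1` makes the constant strictly positive: `couplingConst` vanishes for `T = 0`.
    ⟨CooperativeModel.couplingConst T α θ σ μ₀ lam + 1, ?_, fun N hN Ω _ P _ w x μ h i y ν hy h0 ↦
      (h.lintegral_iSup_sub_le hα hθ hlam T hN i hy h0).trans (ENNReal.ofReal_le_ofReal ?_)⟩⟩
  · linarith [CooperativeModel.couplingConst_nonneg (T := T) (α := α) (σ := σ) (μ₀ := μ₀)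
      (lam := lam) hθ]
  · gcongr
    linarith
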